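/- **Setting.** Let $D\ge 1$ and let $\mathcal S$ be the set of states, i.e. the positive semidefinite matrices $\rho\in\mathbb C^{D\times D}$ with $\operatorname{tr}\rho=1$. For states $A,B$ put $m(A,B)=\sup\{x\in\mathbb R: xB\le A\}$ and $d(A,B)=\dfrac{1-m(A,B)\,m(B,A)}{1+m(A,B)\,m(B,A)}$. For a positive linear map $\psi$ on $\mathbb C^{D\times D}$ (one that preserves positive semidefiniteness) with $\ker\psi\cap\mathcal S=\emptyset$, put $\psi\cdot\rho=\psi(\rho)/\operatorname{tr}\psi(\rho)$ for $\rho\in\mathcal S$, and let the contraction coefficient be $c(\psi)=\sup\{d(\psi\cdot A,\psi\cdot B):A,B\in\mathcal S\}\in[0,1]$. The map $\psi$ is called strictly positive if $\psi(A)$ is positive definite for every positive semidefinite $A\neq 0$. Let $(\Omega,\mathcal F,\mathbb P)$ be a probability space with a one-parameter group $(\theta_h)_{h\in\mathbb R}$ of measurable, $\mathbb P$-preserving maps, and let $(\varphi_{s,t})_{s<t}$, $s,t\in\mathbb R$, be random linear maps on $\mathbb C^{D\times D}$ such that 1. almost surely, for all $s<t$, $\varphi_{s,t}$ is positive and $\ker\varphi_{s,t}\cap\mathcal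 S=\emptyset$; 2. almost surely, $\varphi_{s,t}=\varphi_{r,t}\circ\varphi_{s,r}$ for all $s<r<t$; 3. for all $h$ and all $s<t$, $\varphi_{s+h,t+h}^{\omega}=\varphi_{s,t}^{\theta_h\omega}$ for almost every $\omega$; 4. almost surely, there are $s<t$ such that $\varphi_{s,t}$ is strictly positive. **Lemma.** There is a random variable $\kappa\ge 0$ such that, almost surely, $\kappa<1$ and $$\ln\kappa=\lim_{t\to\infty}\frac1t\ln c(\varphi_{0,t})=\lim_{s\to-\infty}\frac1{|s|}\ln c(\varphi_{s,0}),$$ where $t$ and $s$ are real, $\ln 0=-\infty$, and the limits are taken in $[-\infty,\infty]$. Moreover, for every $h\in\mathbb R$, $\kappa\circ\theta_h=\kappa$ almost surely. If $(\theta_h)_{h\in\mathbb R}$ is ergodic (every event $A$ with $\mathbb P(\theta_h^{-1}A\,\triangle\,A)=0$ for all $h$ has probability $0$ or $1$), then there is a constant $k\in[0,1)$ with $\kappa=k$ almost surely. -/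

import Mathlib

open scoped ComplexOrder

namespace StationaryQuantum

/-- Super-operators: linear maps on the `D × D` complex matrices. -/
abbrev SuperOp (D : ℕ) : Type :=
  Matrix (Fin D) (Fin D) ℂ →ₗ[ℂ] Matrix (Fin D) (Fin D) ℂ

/-- The states (density matrices): positive semidefinite matrices of trace one. -/
def states (D : ℕ) : Set (Matrix (Fin D) (Fin D) ℂ) :=
  {ρ | ρ.PosSemidef ∧ ρ.trace = 1}

/-- A super-operator is positive if it maps the positive semidefinite cone into itself. -/
def IsPositiveMap {D : ℕ} (ψ : SuperOp D) : Prop :=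
  ∀ A : Matrix (Fin D) (Fin D) ℂ, A.PosSemidef → (ψ A).PosSemidef

/-- A super-operator is strictly positive if it maps every nonzero positive semidefinite matrix
to a positive definite one. -/
def IsStrictlyPositiveMap {D : ℕ} (ψ : SuperOp D) : Prop :=
  ∀ A : Matrix (Fin D) (Fin D) ℂ, A.PosSemidef → A ≠ 0 → (ψ A).PosDef

/-- No state is annihilated: `ker ψ ∩ states = ∅`. -/
def IsNonDestructive {D : ℕ} (ψ : SuperOp D) : Prop :=
  ∀ ρ ∈ states D, ψ ρ ≠ 0

/-- The projective action `ψ · ρ = ψ(ρ) / tr ψ(ρ)`. -/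
noncomputable def projAct {D : ℕ} (ψ : SuperOp D) (ρ : Matrix (Fin D) (Fin D) ℂ) :
    Matrix (Fin D) (Fin D) ℂ :=
  (ψ ρ).trace⁻¹ • ψ ρ

/-- `m(A, B) = sup {x ∈ ℝ : x B ≤ A}` in the Loewner order. For states `A, B` the set contains `0`
and is bounded above by `1`. -/
noncomputable def mcoef {D : ℕ} (A B : Matrix (Fin D) (Fin D) ℂ) : ℝ :=
  sSup {x : ℝ | (A - (x : ℂ) • B).PosSemidef}

/-- The projective metric on states,
`d(A, B) = (1 - m(A, B) m(B, A)) / (1 + m(A, B) m(B, A))`. -/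
noncomputable def projDist {D : ℕ} (A B : Matrix (Fin D) (Fin D) ℂ) : ℝ :=
  (1 - mcoef A B * mcoef B A) / (1 + mcoef A B * mcoef B A)

/-- The contraction coefficient `c(ψ) = sup {d(ψ · A, ψ · B) : A, B states}`. -/
noncomputable def contractionCoeff {D : ℕ} (ψ : SuperOp D) : ℝ :=
  sSup {r : ℝ | ∃ A ∈ states D, ∃ B ∈ states D, r = projDist (projAct ψ A) (projAct ψ B)}

/-- The logarithm of a nonnegative real number with values in `[-∞, ∞)`, where `ln 0 = -∞`. -/
noncomputable def ln (x : ℝ) : EReal := ENNReal.log (ENNReal.ofReal x)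

/-- A dynamical propagator `(φ_{s,t})_{s<t}` in a stationary environment. The environment is the
probability space `(Ω, μ)` with the one-parameter group of measure-preserving shifts
`θ_h ω = h +ᵥ ω`. Only the values `φ s t` with `s < t` are constrained. -/
structure IsDynamicalPropagator {D : ℕ} {Ω : Type*} [MeasurableSpace Ω]
    (μ : MeasureTheory.Measure Ω) [AddAction ℝ Ω] (φ : ℝ → ℝ → Ω → SuperOp D) : Prop where
  /-- Each `φ_{s,t}` is a random super-operator. -/
  measurable : ∀ s t : ℝ, s < t → ∀ (X : Matrix (Fin D) (Fin D) ℂ) (i j : Fin D),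
    Measurable (fun ω => φ s t ω X i j)
  /-- Almost surely, all `φ_{s,t}` are positive. -/
  positive : ∀ᵐ ω ∂μ, ∀ s t : ℝ, s < t → IsPositiveMap (φ s t ω)
  /-- Almost surely, `φ_{s,t} = φ_{r,t} ∘ φ_{s,r}` for all `s < r < t`. -/
  propagate : ∀ᵐ ω ∂μ, ∀ s r t : ℝ, s < r → r < t → φ s t ω = φ r t ω ∘ₗ φ s r ω
  /-- `φ_{s+h,t+h}^ω = φ_{s,t}^{θ_h ω}` almost surely. -/
  stationary : ∀ h s t : ℝ, s < t → ∀ᵐ ω ∂μ, φ (s + h) (t + h) ω = φ s t (h +ᵥ ω)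

end StationaryQuantum

/-! An admissible map `ψ` shrinks the projective metric by the factor `c(ψ)`
(`IsAdmissible.projDist_map_le`), so `c` is submultiplicative under composition. Hence `-ln
c(φ_{s,t})`, with values in `[0, ∞]`, is superadditive over adjacent time intervals, and
stationarity makes it a superadditive process over the shift by one time unit.

The limits come from a subadditive ergodic theorem for such processes,
`IsSuperadditive.tendsto_of_inverse`. All values are nonnegative, so Lebesgue integrals in `[0, ∞]`
suffice and no integrability is needed. Its core is a pair of block-covering estimates: frequent
large block means bound the integrals from below (`IsSuperadditive.mul_measure_univ_le`), and small
means along infinitely many times bound them from above (`IsSuperadditive.lintegral_le`). The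
forward and backward processes have equal integrals at each time on sets invariant under both
shifts, so comparing the two bounds there makes the forward and backward limits exist and agree.
Monotonicity in the time interval passes from integer to real times, and `κ` is the exponential of
minus the rate.

The rate does not increase under positive shifts, which for a measure-preserving map forces
invariance. It is positive because on the invariant event where it vanishes the process itself
vanishes (`IsSuperadditive.eq_zero_of_liminf_eq_zero`). By stationarity `c(φ_{-n,n}) = 1` there for
all `n ≥ 1`, whereas some `[-n, n]` contains an interval with a strictly positive map, whose
coefficient is below one by compactness. -/

namespace StationaryQuantum

/-! ### The Loewner order and the projective metric. -/

section Algebra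

variable {D : ℕ}

lemma isClosed_setOf_posSemidef :
    IsClosed {A : Matrix (Fin D) (Fin D) ℂ | A.PosSemidef} := by
  have h : {A : Matrix (Fin D) (Fin D) ℂ | A.PosSemidef} =
      {A | A.conjTranspose = A} ∩
        ⋂ v : Fin D → ℂ, {A | 0 ≤ star v ⬝ᵥ (A.mulVec v)} := by
    ext A
    simp only [Matrix.posSemidef_iff_dotProduct_mulVec, Matrix.IsHermitian, Set.mem_ofPred_eq,
      Set.mem_inter_iff, Set.mem_iInter]
  rw [h]
  refine IsClosed.inter (isClosed_eq (by fun_prop) (by fun_prop)) (isClosed_iInter fun v => ?_)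
  exact isClosed_le continuous_const (by fun_prop)

lemma posSemidef_trace_re_nonneg {A : Matrix (Fin D) (Fin D) ℂ} (hA : A.PosSemidef) :
    0 ≤ A.trace.re := (Complex.nonneg_iff.1 hA.trace_nonneg).1

lemma posSemidef_trace_eq_re {A : Matrix (Fin D) (Fin D) ℂ} (hA : A.PosSemidef) :
    A.trace = (A.trace.re : ℂ) :=
  Complex.ext rfl (by simpa using (Complex.nonneg_iff.1 hA.trace_nonneg).2.symm)

open scoped MatrixOrder in
lemma posSemidef_trace_re_pos {A : Matrix (Fin D) (Fin D) ℂ} (hA : A.PosSemidef) (h0 : A ≠ 0) :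
    0 < A.trace.re := by
  refine lt_of_le_of_ne (posSemidef_trace_re_nonneg hA) fun h => h0 ?_
  obtain ⟨C, rfl⟩ := CStarAlgebra.nonneg_iff_eq_star_mul_self.mp hA.nonneg
  have := posSemidef_trace_eq_re hA
  rw [← h] at this
  rw [Matrix.star_eq_conjTranspose] at *
  have hC := Matrix.trace_conjTranspose_mul_self_eq_zero_iff.1 (by simpa using this)
  simp [hC]

lemma PosSemidef.real_smul {A : Matrix (Fin D) (Fin D) ℂ} (hA : A.PosSemidef) {x : ℝ}
    (hx : 0 ≤ x) : ((x : ℂ) • A).PosSemidef :=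
  hA.smul (by exact_mod_cast hx)

lemma le_trace_div_trace {A B : Matrix (Fin D) (Fin D) ℂ} (hB : B.PosSemidef) (h0 : B ≠ 0) {x : ℝ}
    (h : (A - (x : ℂ) • B).PosSemidef) : x ≤ A.trace.re / B.trace.re := by
  have h1 := posSemidef_trace_re_nonneg h
  rw [le_div_iff₀ (posSemidef_trace_re_pos hB h0)]
  simp [Matrix.trace_sub, Matrix.trace_smul] at h1
  linarith

lemma bddAbove_mcoef {A B : Matrix (Fin D) (Fin D) ℂ} (hB : B.PosSemidef) (h0 : B ≠ 0) :
    BddAbove {x : ℝ | (A - (x : ℂ) • B).PosSemidef} :=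
  ⟨_, fun _ h => le_trace_div_trace hB h0 h⟩

lemma le_mcoef {A B : Matrix (Fin D) (Fin D) ℂ} (hB : B.PosSemidef) (h0 : B ≠ 0) {x : ℝ}
    (h : (A - (x : ℂ) • B).PosSemidef) : x ≤ mcoef A B :=
  le_csSup (bddAbove_mcoef hB h0) h

lemma mcoef_nonneg {A B : Matrix (Fin D) (Fin D) ℂ} (hA : A.PosSemidef) (hB : B.PosSemidef)
    (h0 : B ≠ 0) : 0 ≤ mcoef A B :=
  le_mcoef hB h0 (by simpa using hA)

lemma posSemidef_sub_mcoef {A B : Matrix (Fin D) (Fin D) ℂ} (hA : A.PosSemidef)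
    (hB : B.PosSemidef) (h0 : B ≠ 0) : (A - (mcoef A B : ℂ) • B).PosSemidef := by
  have hc : IsClosed {x : ℝ | (A - (x : ℂ) • B).PosSemidef} :=
    isClosed_setOf_posSemidef.preimage (f := fun x : ℝ => A - (x : ℂ) • B) (by fun_prop)
  exact hc.csSup_mem ⟨0, by simpa using hA⟩ (bddAbove_mcoef hB h0)

lemma le_mcoef_iff {A B : Matrix (Fin D) (Fin D) ℂ} (hA : A.PosSemidef) (hB : B.PosSemidef)
    (h0 : B ≠ 0) {x : ℝ} : x ≤ mcoef A B ↔ (A - (x : ℂ) • B).PosSemidef := by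
  refine ⟨fun h => ?_, le_mcoef hB h0⟩
  have := (posSemidef_sub_mcoef hA hB h0).add (PosSemidef.real_smul hB (sub_nonneg.2 h))
  convert this using 1
  push_cast
  module

/-- Chaining `B ≥ m(B,A) A` with `A ≥ m(A,B) B` compares `B` with a multiple of itself; the trace
then decides. -/
lemma mcoef_mul_le_one {A B : Matrix (Fin D) (Fin D) ℂ} (hA : A.PosSemidef) (hA0 : A ≠ 0)
    (hB : B.PosSemidef) (hB0 : B ≠ 0) : mcoef A B * mcoef B A ≤ 1 := by
  have h1 := posSemidef_sub_mcoef hA hB hB0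
  have h2 := posSemidef_sub_mcoef hB hA hA0
  have h3 := h2.add (PosSemidef.real_smul h1 (mcoef_nonneg hB hA hA0))
  have h4 : (((1 - mcoef A B * mcoef B A : ℝ) : ℂ) • B).PosSemidef := by
    convert h3 using 1
    push_cast
    module
  have h5 := posSemidef_trace_re_nonneg h4
  simp only [Matrix.trace_smul, smul_eq_mul, Complex.re_ofReal_mul] at h5
  nlinarith [nonneg_of_mul_nonneg_left h5 (posSemidef_trace_re_pos hB hB0)]

lemma one_sub_div_one_add_anti {a b : ℝ} (ha : 0 ≤ a) (hab : a ≤ b) :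
    (1 - b) / (1 + b) ≤ (1 - a) / (1 + a) := by
  rw [div_le_div_iff₀ (by linarith) (by linarith)]
  nlinarith

lemma projDist_nonneg {A B : Matrix (Fin D) (Fin D) ℂ} (hA : A.PosSemidef) (hA0 : A ≠ 0)
    (hB : B.PosSemidef) (hB0 : B ≠ 0) : 0 ≤ projDist A B :=
  div_nonneg (sub_nonneg.2 (mcoef_mul_le_one hA hA0 hB hB0))
    (add_nonneg zero_le_one (mul_nonneg (mcoef_nonneg hA hB hB0) (mcoef_nonneg hB hA hA0)))

lemma projDist_le_one {A B : Matrix (Fin D) (Fin D) ℂ} (hA : A.PosSemidef) (hA0 : A ≠ 0)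
    (hB : B.PosSemidef) (hB0 : B ≠ 0) : projDist A B ≤ 1 := by
  have := one_sub_div_one_add_anti le_rfl
    (mul_nonneg (mcoef_nonneg hA hB hB0) (mcoef_nonneg hB hA hA0))
  simpa [projDist] using this

lemma projDist_le {A B : Matrix (Fin D) (Fin D) ℂ} (hA : A.PosSemidef) (hA0 : A ≠ 0)
    (hB : B.PosSemidef) (hB0 : B ≠ 0) {x y : ℝ} (hx : 0 ≤ x) (hy : 0 ≤ y)
    (h1 : (A - (x : ℂ) • B).PosSemidef) (h2 : (B - (y : ℂ) • A).PosSemidef) :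
    projDist A B ≤ (1 - x * y) / (1 + x * y) :=
  one_sub_div_one_add_anti (mul_nonneg hx hy)
    (mul_le_mul (le_mcoef hB hB0 h1) (le_mcoef hA hA0 h2) hy (mcoef_nonneg hA hB hB0))

lemma real_smul_ne_zero {A : Matrix (Fin D) (Fin D) ℂ} (hA0 : A ≠ 0) {s : ℝ} (hs : 0 < s) :
    (s : ℂ) • A ≠ 0 :=
  smul_ne_zero (by exact_mod_cast hs.ne') hA0

lemma projDist_smul_smul_le {A B : Matrix (Fin D) (Fin D) ℂ} (hA : A.PosSemidef) (hA0 : A ≠ 0)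
    (hB : B.PosSemidef) (hB0 : B ≠ 0) {s t : ℝ} (hs : 0 < s) (ht : 0 < t) :
    projDist ((s : ℂ) • A) ((t : ℂ) • B) ≤ projDist A B := by
  have hsc : (s : ℂ) ≠ 0 := by exact_mod_cast hs.ne'
  have htc : (t : ℂ) ≠ 0 := by exact_mod_cast ht.ne'
  have m1 := mcoef_nonneg hA hB hB0
  have m2 := mcoef_nonneg hB hA hA0
  have := projDist_le (x := s * mcoef A B / t) (y := t * mcoef B A / s)
    (PosSemidef.real_smul hA hs.le) (real_smul_ne_zero hA0 hs) (PosSemidef.real_smul hB ht.le)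
    (real_smul_ne_zero hB0 ht) (by positivity) (by positivity)
    (by
      convert PosSemidef.real_smul (posSemidef_sub_mcoef hA hB hB0) hs.le using 1
      push_cast
      rw [smul_sub, smul_smul, smul_smul]
      congr 2
      field_simp)
    (by
      convert PosSemidef.real_smul (posSemidef_sub_mcoef hB hA hA0) ht.le using 1
      push_cast
      rw [smul_sub, smul_smul, smul_smul]
      congr 2
      field_simp)
  have e : s * mcoef A B / t * (t * mcoef B A / s) = mcoef A B * mcoef B A := by field_simp
  rwa [e] at this

lemma projDist_smul_smul {A B : Matrix (Fin D) (Fin D) ℂ} (hA : A.PosSemidef) (hA0 : A ≠ 0)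
    (hB : B.PosSemidef) (hB0 : B ≠ 0) {s t : ℝ} (hs : 0 < s) (ht : 0 < t) :
    projDist ((s : ℂ) • A) ((t : ℂ) • B) = projDist A B := by
  refine le_antisymm (projDist_smul_smul_le hA hA0 hB hB0 hs ht) ?_
  have hsc : (s : ℂ) ≠ 0 := by exact_mod_cast hs.ne'
  have htc : (t : ℂ) ≠ 0 := by exact_mod_cast ht.ne'
  have := projDist_smul_smul_le (PosSemidef.real_smul hA hs.le) (real_smul_ne_zero hA0 hs)
    (PosSemidef.real_smul hB ht.le) (real_smul_ne_zero hB0 ht) (inv_pos.2 hs) (inv_pos.2 ht)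
  rwa [smul_smul, smul_smul, Complex.ofReal_inv, Complex.ofReal_inv, inv_mul_cancel₀ hsc,
    inv_mul_cancel₀ htc, one_smul, one_smul] at this

/-- Were the difference zero, `A` and `B` would be proportional and the product of the two
coefficients would be at least one. -/
lemma sub_mcoef_smul_ne_zero {A B : Matrix (Fin D) (Fin D) ℂ} (hA : A.PosSemidef) (hA0 : A ≠ 0)
    (hB : B.PosSemidef) (hB0 : B ≠ 0) (h : mcoef A B * mcoef B A < 1) :
    A - (mcoef A B : ℂ) • B ≠ 0 := by
  intro h0
  have e : A = (mcoef A B : ℂ) • B := sub_eq_zero.1 h0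
  have hm : mcoef A B ≠ 0 := by
    intro h1
    rw [h1] at e
    exact hA0 (by simpa using e)
  have hmc : (mcoef A B : ℂ) ≠ 0 := by exact_mod_cast hm
  have e' : B - (((mcoef A B)⁻¹ : ℝ) : ℂ) • A = 0 := by
    rw [sub_eq_zero, Complex.ofReal_inv, eq_inv_smul_iff₀ hmc]
    exact e.symm
  have h2 : (mcoef A B)⁻¹ ≤ mcoef B A :=
    le_mcoef hA hA0 (by rw [e']; exact Matrix.PosSemidef.zero)
  have hm0 : 0 < mcoef A B := by
    exact lt_of_le_of_ne (mcoef_nonneg hA hB hB0) (Ne.symm hm)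
  rw [inv_le_iff_one_le_mul₀' hm0] at h2
  linarith

/-! ### Contraction coefficients and submultiplicativity. -/

/-- A positive map which annihilates no state. -/
def IsAdmissible (ψ : SuperOp D) : Prop := IsPositiveMap ψ ∧ IsNonDestructive ψ

lemma states_ne_zero {A : Matrix (Fin D) (Fin D) ℂ} (hA : A ∈ states D) : A ≠ 0 := by
  rintro rfl
  simpa using hA.2

lemma normalize_mem_states {A : Matrix (Fin D) (Fin D) ℂ} (hA : A.PosSemidef) (h0 : A ≠ 0) :
    ((A.trace.re⁻¹ : ℝ) : ℂ) • A ∈ states D := by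
  have h := posSemidef_trace_re_pos hA h0
  refine ⟨PosSemidef.real_smul hA (inv_pos.2 h).le, ?_⟩
  rw [Matrix.trace_smul, posSemidef_trace_eq_re hA, smul_eq_mul]
  norm_cast
  simp [h.ne']

lemma IsAdmissible.map_ne_zero {ψ : SuperOp D} (hψ : IsAdmissible ψ)
    {A : Matrix (Fin D) (Fin D) ℂ} (hA : A.PosSemidef) (h0 : A ≠ 0) : ψ A ≠ 0 := by
  intro h
  apply hψ.2 _ (normalize_mem_states hA h0)
  rw [map_smul, h, smul_zero]

lemma IsAdmissible.comp {ψ χ : SuperOp D} (hψ : IsAdmissible ψ) (hχ : IsAdmissible χ) :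
    IsAdmissible (ψ ∘ₗ χ) :=
  ⟨fun A hA => hψ.1 _ (hχ.1 A hA), fun _ hρ =>
    hψ.map_ne_zero (hχ.1 _ hρ.1) (hχ.map_ne_zero hρ.1 (states_ne_zero hρ))⟩

lemma projAct_eq {ψ : SuperOp D} (hψ : IsPositiveMap ψ) {A : Matrix (Fin D) (Fin D) ℂ}
    (hA : A.PosSemidef) : projAct ψ A = (((ψ A).trace.re⁻¹ : ℝ) : ℂ) • ψ A := by
  rw [projAct, posSemidef_trace_eq_re (hψ A hA)]
  push_cast
  rfl

lemma IsAdmissible.projDist_projAct {ψ : SuperOp D} (hψ : IsAdmissible ψ)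
    {A B : Matrix (Fin D) (Fin D) ℂ} (hA : A ∈ states D) (hB : B ∈ states D) :
    projDist (projAct ψ A) (projAct ψ B) = projDist (ψ A) (ψ B) := by
  have hA0 := hψ.2 A hA
  have hB0 := hψ.2 B hB
  rw [projAct_eq hψ.1 hA.1, projAct_eq hψ.1 hB.1]
  exact projDist_smul_smul (hψ.1 A hA.1) hA0 (hψ.1 B hB.1) hB0
    (inv_pos.2 (posSemidef_trace_re_pos (hψ.1 A hA.1) hA0))
    (inv_pos.2 (posSemidef_trace_re_pos (hψ.1 B hB.1) hB0))

lemma IsAdmissible.contractionCoeff_eq {ψ : SuperOp D} (hψ : IsAdmissible ψ) :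
    contractionCoeff ψ = sSup {r : ℝ | ∃ A ∈ states D, ∃ B ∈ states D,
      r = projDist (ψ A) (ψ B)} := by
  unfold contractionCoeff
  congr 1
  ext r
  constructor
  · rintro ⟨A, hA, B, hB, rfl⟩
    exact ⟨A, hA, B, hB, hψ.projDist_projAct hA hB⟩
  · rintro ⟨A, hA, B, hB, rfl⟩
    exact ⟨A, hA, B, hB, (hψ.projDist_projAct hA hB).symm⟩

lemma IsAdmissible.projDist_map_le_one {ψ : SuperOp D} (hψ : IsAdmissible ψ)
    {A B : Matrix (Fin D) (Fin D) ℂ} (hA : A ∈ states D) (hB : B ∈ states D) :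
    projDist (ψ A) (ψ B) ≤ 1 :=
  projDist_le_one (hψ.1 A hA.1) (hψ.2 A hA) (hψ.1 B hB.1) (hψ.2 B hB)

lemma IsAdmissible.projDist_le_contractionCoeff_of_states {ψ : SuperOp D} (hψ : IsAdmissible ψ)
    {A B : Matrix (Fin D) (Fin D) ℂ} (hA : A ∈ states D) (hB : B ∈ states D) :
    projDist (ψ A) (ψ B) ≤ contractionCoeff ψ := by
  rw [hψ.contractionCoeff_eq]
  refine le_csSup ⟨1, ?_⟩ ⟨A, hA, B, hB, rfl⟩
  rintro r ⟨A, hA, B, hB, rfl⟩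
  exact hψ.projDist_map_le_one hA hB

lemma IsAdmissible.projDist_le_contractionCoeff {ψ : SuperOp D} (hψ : IsAdmissible ψ)
    {A B : Matrix (Fin D) (Fin D) ℂ} (hA : A.PosSemidef) (hA0 : A ≠ 0) (hB : B.PosSemidef)
    (hB0 : B ≠ 0) : projDist (ψ A) (ψ B) ≤ contractionCoeff ψ := by
  have := hψ.projDist_le_contractionCoeff_of_states (normalize_mem_states hA hA0)
    (normalize_mem_states hB hB0)
  rw [map_smul, map_smul] at this
  rwa [projDist_smul_smul (hψ.1 A hA) (hψ.map_ne_zero hA hA0) (hψ.1 B hB) (hψ.map_ne_zero hB hB0)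
    (inv_pos.2 (posSemidef_trace_re_pos hA hA0)) (inv_pos.2 (posSemidef_trace_re_pos hB hB0))]
    at this

lemma states_nonempty [NeZero D] : (states D).Nonempty :=
  ⟨_, normalize_mem_states Matrix.PosSemidef.one one_ne_zero⟩

lemma IsAdmissible.contractionCoeff_le [NeZero D] {ψ : SuperOp D} (hψ : IsAdmissible ψ) {r : ℝ}
    (h : ∀ A ∈ states D, ∀ B ∈ states D, projDist (ψ A) (ψ B) ≤ r) : contractionCoeff ψ ≤ r := by
  obtain ⟨A, hA⟩ := states_nonempty (D := D)
  rw [hψ.contractionCoeff_eq]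
  refine csSup_le ⟨_, A, hA, A, hA, rfl⟩ ?_
  rintro r ⟨A, hA, B, hB, rfl⟩
  exact h A hA B hB

lemma IsAdmissible.contractionCoeff_le_one [NeZero D] {ψ : SuperOp D} (hψ : IsAdmissible ψ) :
    contractionCoeff ψ ≤ 1 :=
  hψ.contractionCoeff_le fun _ hA _ hB => hψ.projDist_map_le_one hA hB

lemma IsAdmissible.contractionCoeff_nonneg [NeZero D] {ψ : SuperOp D} (hψ : IsAdmissible ψ) :
    0 ≤ contractionCoeff ψ := by
  obtain ⟨A, hA⟩ := states_nonempty (D := D)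
  exact (projDist_nonneg (hψ.1 A hA.1) (hψ.2 A hA) (hψ.1 A hA.1) (hψ.2 A hA)).trans
    (hψ.projDist_le_contractionCoeff_of_states hA hA)

/-- A positive map contracts the projective metric by the factor `contractionCoeff ψ`. -/
lemma IsAdmissible.projDist_map_le {ψ : SuperOp D} (hψ : IsAdmissible ψ)
    {A B : Matrix (Fin D) (Fin D) ℂ} (hA : A.PosSemidef) (hA0 : A ≠ 0) (hB : B.PosSemidef)
    (hB0 : B ≠ 0) : projDist (ψ A) (ψ B) ≤ contractionCoeff ψ * projDist A B := by
  set m := mcoef A B with hm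
  set m' := mcoef B A with hm'
  have m0 : 0 ≤ m := mcoef_nonneg hA hB hB0
  have m0' : 0 ≤ m' := mcoef_nonneg hB hA hA0
  have hM := posSemidef_sub_mcoef hA hB hB0
  have hM' := posSemidef_sub_mcoef hB hA hA0
  rw [← hm] at hM
  rw [← hm'] at hM'
  have hmm : m * m' ≤ 1 := mcoef_mul_le_one hA hA0 hB hB0
  have hψA := hψ.1 A hA
  have hψB := hψ.1 B hB
  have hψA0 := hψ.map_ne_zero hA hA0
  have hψB0 := hψ.map_ne_zero hB hB0
  -- When `m * m' = 1` the matrices are at distance zero and the differences `M`, `M'` below may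
  -- vanish, so this case is separate.
  rcases hmm.eq_or_lt with h1 | h1
  · have hd : projDist A B = 0 := by rw [projDist, ← hm, ← hm', h1]; simp
    rw [hd, mul_zero]
    refine (projDist_le hψA hψA0 hψB hψB0 m0 m0' (by simpa using hψ.1 _ hM)
      (by simpa using hψ.1 _ hM')).trans ?_
    simp [h1]
  -- `M` and `M'` are the extremal positive combinations of `A` and `B`. The coefficient of `ψ` is
  -- applied to this pair, not to `A` and `B`.
  set M := A - (m : ℂ) • B with hMd
  set M' := B - (m' : ℂ) • A with hMd'
  have hk : (0 : ℝ) < 1 - m * m' := by linarith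
  have hM0 : M ≠ 0 := sub_mcoef_smul_ne_zero hA hA0 hB hB0 h1
  have hM0' : M' ≠ 0 := sub_mcoef_smul_ne_zero hB hB0 hA hA0 (by rwa [mul_comm])
  set P := ψ M with hP
  set Q := ψ M' with hQ
  set p := mcoef P Q with hp
  set q := mcoef Q P with hq
  have hPp := hψ.1 M hM
  have hQp := hψ.1 M' hM'
  have hP0 := hψ.map_ne_zero hM hM0
  have hQ0 := hψ.map_ne_zero hM' hM0'
  rw [← hP] at hPp hP0
  rw [← hQ] at hQp hQ0
  have p0 : 0 ≤ p := mcoef_nonneg hPp hQp hQ0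
  have q0 : 0 ≤ q := mcoef_nonneg hQp hPp hP0
  have hpq : p * q ≤ 1 := mcoef_mul_le_one hPp hP0 hQp hQ0
  have hPQ := posSemidef_sub_mcoef hPp hQp hQ0
  have hQP := posSemidef_sub_mcoef hQp hPp hP0
  rw [← hp] at hPQ
  rw [← hq] at hQP
  have hc : (1 - p * q) / (1 + p * q) ≤ contractionCoeff ψ :=
    hψ.projDist_le_contractionCoeff hM hM0 hM' hM0'
  have hkc : ((1 - m * m' : ℝ) : ℂ) ≠ 0 := by exact_mod_cast hk.ne'
  have eP : P = ψ A - (m : ℂ) • ψ B := by rw [hP, hMd, map_sub, map_smul]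
  have eQ : Q = ψ B - (m' : ℂ) • ψ A := by rw [hQ, hMd', map_sub, map_smul]
  have d1 : (0 : ℝ) < 1 + m' * p := by positivity
  have d2 : (0 : ℝ) < 1 + m * q := by positivity
  have d1c : (1 + m' * p : ℂ) ≠ 0 := by exact_mod_cast d1.ne'
  have d2c : (1 + m * q : ℂ) ≠ 0 := by exact_mod_cast d2.ne'
  -- `P - p Q = (1 + m' p) ψ A - (m + p) ψ B`, so positivity of the left side bounds `mcoef (ψ A) (ψ
  -- B)` from below; `hy` is the mirror image.
  have hx : (ψ A - (((m + p) / (1 + m' * p) : ℝ) : ℂ) • ψ B).PosSemidef := by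
    convert PosSemidef.real_smul hPQ (inv_pos.2 d1).le using 1
    rw [eP, eQ]
    push_cast
    rw [← smul_right_injective _ d1c |>.eq_iff]
    simp only [smul_sub, smul_smul, mul_div_cancel₀ _ d1c, mul_inv_cancel₀ d1c,
      mul_inv_cancel_left₀ d1c, one_smul]
    module
  have hy : (ψ B - (((m' + q) / (1 + m * q) : ℝ) : ℂ) • ψ A).PosSemidef := by
    convert PosSemidef.real_smul hQP (inv_pos.2 d2).le using 1
    rw [eP, eQ]
    push_cast
    rw [← smul_right_injective _ d2c |>.eq_iff]
    simp only [smul_sub, smul_smul, mul_div_cancel₀ _ d2c, mul_inv_cancel₀ d2c,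
      mul_inv_cancel_left₀ d2c, one_smul]
    module
  calc projDist (ψ A) (ψ B)
      ≤ (1 - (m + p) / (1 + m' * p) * ((m' + q) / (1 + m * q))) /
          (1 + (m + p) / (1 + m' * p) * ((m' + q) / (1 + m * q))) :=
        projDist_le hψA hψA0 hψB hψB0 (by positivity) (by positivity) hx hy
    _ = ((1 - m * m') * (1 - p * q)) /
          ((1 + m * m') * (1 + p * q) + 2 * (m * q) + 2 * (m' * p)) := by
        field_simp
        ring
    -- Dropping the nonnegative cross terms from the denominator leaves a product of two distances.
    _ ≤ ((1 - m * m') * (1 - p * q)) / ((1 + m * m') * (1 + p * q)) := by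
        apply div_le_div_of_nonneg_left
        · exact mul_nonneg hk.le (by linarith)
        · positivity
        · nlinarith [mul_nonneg m0 q0, mul_nonneg m0' p0]
    _ = (1 - p * q) / (1 + p * q) * projDist A B := by
        rw [projDist, ← hm, ← hm', div_mul_div_comm]
        ring
    _ ≤ contractionCoeff ψ * projDist A B :=
        mul_le_mul_of_nonneg_right hc (projDist_nonneg hA hA0 hB hB0)

lemma contractionCoeff_comp_le [NeZero D] {ψ χ : SuperOp D} (hψ : IsAdmissible ψ)
    (hχ : IsAdmissible χ) :
    contractionCoeff (ψ ∘ₗ χ) ≤ contractionCoeff ψ * contractionCoeff χ := by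
  refine (hψ.comp hχ).contractionCoeff_le fun A hA B hB => ?_
  refine (hψ.projDist_map_le (hχ.1 A hA.1) (hχ.2 A hA) (hχ.1 B hB.1) (hχ.2 B hB)).trans ?_
  exact mul_le_mul_of_nonneg_left (hχ.projDist_le_contractionCoeff_of_states hA hB)
    hψ.contractionCoeff_nonneg

/-! ### Strict contraction by strictly positive maps. -/

/-- The pairs consisting of a matrix `C` and a vector `v`, both of Euclidean norm one. -/
def unitPairs (D : ℕ) : Set (Matrix (Fin D) (Fin D) ℂ × (Fin D → ℂ)) :=
  {p | (p.1.conjTranspose * p.1).trace = 1 ∧ star p.2 ⬝ᵥ p.2 = 1}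

lemma isCompact_unitPairs : IsCompact (unitPairs D) := by
  have hs : ∀ {ι : Type} [Fintype ι] (f : ι → ℂ), ∑ i, star (f i) * f i = 1 → ∀ i, ‖f i‖ ≤ 1 := by
    intro ι _ f h i
    have h1 : ∑ i, ‖f i‖ ^ 2 = 1 := by
      have : ∀ i, star (f i) * f i = ((‖f i‖ ^ 2 : ℝ) : ℂ) := fun i => by
        rw [Complex.star_def, Complex.conj_mul']
        push_cast
        rfl
      simp only [this] at h
      exact_mod_cast h
    have h2 : ‖f i‖ ^ 2 ≤ 1 := h1 ▸ Finset.single_le_sum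
      (f := fun i => ‖f i‖ ^ 2) (fun i _ => by positivity) (Finset.mem_univ i)
    exact (sq_le_one_iff₀ (norm_nonneg _)).1 h2
  have hK : IsCompact ((Set.univ.pi fun _ : Fin D => Set.univ.pi fun _ : Fin D =>
      Metric.closedBall (0 : ℂ) 1) ×ˢ (Set.univ.pi fun _ : Fin D => Metric.closedBall (0 : ℂ) 1)) :=
    (isCompact_univ_pi fun _ => isCompact_univ_pi fun _ => isCompact_closedBall _ _).prod
      (isCompact_univ_pi fun _ => isCompact_closedBall _ _)
  refine IsCompact.of_isClosed_subset (s := _) hK ?_ ?_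
  · exact (isClosed_eq (by fun_prop) continuous_const).inter
      (isClosed_eq (by unfold dotProduct; fun_prop) continuous_const)
  · rintro ⟨C, v⟩ ⟨h1, h2⟩
    refine ⟨fun i _ j _ => ?_, fun i _ => ?_⟩
    · have := hs (fun p : Fin D × Fin D => C p.2 p.1) (by
        rw [Fintype.sum_prod_type]
        simpa [Matrix.trace, Matrix.mul_apply] using h1) (j, i)
      simpa using this
    · simpa using hs v h2 i

lemma exists_unit_multiple {v : Fin D → ℂ} (hv : v ≠ 0) :
    ∃ (r : ℝ) (u : Fin D → ℂ), v = (r : ℂ) • u ∧ star u ⬝ᵥ u = 1 := by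
  have h : 0 < star v ⬝ᵥ v := Matrix.dotProduct_star_self_pos_iff.2 hv
  obtain ⟨s, hs⟩ : ∃ s : ℝ, star v ⬝ᵥ v = s := ⟨(star v ⬝ᵥ v).re,
    Complex.ext rfl (by simpa using (Complex.pos_iff.1 h).2.symm)⟩
  have hs0 : 0 < s := by rw [hs] at h; exact_mod_cast h
  have hq := Real.sqrt_pos.2 hs0
  have hqc : ((Real.sqrt s : ℝ) : ℂ) ≠ 0 := by exact_mod_cast hq.ne'
  refine ⟨Real.sqrt s, ((Real.sqrt s)⁻¹ : ℂ) • v, ?_, ?_⟩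
  · rw [smul_smul, mul_inv_cancel₀ hqc, one_smul]
  · rw [star_smul, smul_dotProduct, dotProduct_smul, hs]
    simp only [smul_eq_mul, Complex.star_def, map_inv₀, Complex.conj_ofReal]
    field_simp
    norm_cast
    exact (Real.sq_sqrt hs0.le).symm

-- States are the matrices `C* C` with `C` of norm one, so the quadratic forms of all `ψ A` at unit
-- vectors are values of one continuous positive function `F` on a compact set. The ratio `x` of its
-- lower to its upper bound gives `x ψ B ≤ ψ A` uniformly in the states `A`, `B`.
open scoped MatrixOrder in
lemma IsStrictlyPositiveMap.contractionCoeff_lt_one [NeZero D] {ψ : SuperOp D}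
    (hψ : IsStrictlyPositiveMap ψ) (ha : IsAdmissible ψ) : contractionCoeff ψ < 1 := by
  let F : Matrix (Fin D) (Fin D) ℂ × (Fin D → ℂ) → ℝ := fun p =>
    (star p.2 ⬝ᵥ (ψ (p.1.conjTranspose * p.1)).mulVec p.2).re
  have hψc : Continuous ψ := LinearMap.continuous_of_finiteDimensional ψ
  have hF : Continuous F := by
    have : Continuous fun p : Matrix (Fin D) (Fin D) ℂ × (Fin D → ℂ) =>
      ψ (p.1.conjTranspose * p.1) := hψc.comp (by fun_prop)
    unfold F dotProduct
    fun_prop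
  have hF0 : ∀ p ∈ unitPairs D, 0 < F p := by
    rintro ⟨C, v⟩ ⟨h1, h2⟩
    have hC : C.conjTranspose * C ≠ 0 := by
      intro h
      simp [h] at h1
    have hv : v ≠ 0 := by
      rintro rfl
      simp at h2
    exact (Complex.pos_iff.1 ((hψ _ (Matrix.posSemidef_conjTranspose_mul_self C)
      hC).dotProduct_mulVec_pos hv)).1
  obtain ⟨δ, hδ, hδF⟩ : ∃ δ > 0, ∀ p ∈ unitPairs D, δ ≤ F p := by
    rcases (unitPairs D).eq_empty_or_nonempty with h | h
    · exact ⟨1, one_pos, by simp [h]⟩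
    · obtain ⟨p, hp, hmin⟩ := isCompact_unitPairs.exists_isMinOn h hF.continuousOn
      exact ⟨F p, hF0 p hp, fun q hq => hmin hq⟩
  obtain ⟨K, hK⟩ := (isCompact_unitPairs (D := D)).exists_bound_of_continuousOn hF.continuousOn
  -- Replacing `K` by `max K 1` makes the divisor positive without inspecting `K`.
  have hK' : ∀ p ∈ unitPairs D, F p ≤ max K 1 := fun p hp =>
    ((le_abs_self _).trans (hK p hp)).trans (le_max_left _ _)
  have hK1 : 0 < max K 1 := lt_max_of_lt_right one_pos
  set x := δ / max K 1 with hx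
  have hx0 : 0 < x := div_pos hδ hK1
  have key : ∀ A ∈ states D, ∀ B ∈ states D, (ψ A - (x : ℂ) • ψ B).PosSemidef := by
    intro A hA B hB
    have hH : (ψ A - (x : ℂ) • ψ B).IsHermitian :=
      (ha.1 A hA.1).isHermitian.sub (PosSemidef.real_smul (ha.1 B hB.1) hx0.le).isHermitian
    refine Matrix.PosSemidef.of_dotProduct_mulVec_nonneg hH fun v => ?_
    have him := hH.im_star_dotProduct_mulVec_self v
    rw [Complex.nonneg_iff]
    refine ⟨?_, by simpa using him.symm⟩
    rcases eq_or_ne v 0 with rfl | hv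
    · simp
    obtain ⟨C, rfl⟩ := CStarAlgebra.nonneg_iff_eq_star_mul_self.mp hA.1.nonneg
    obtain ⟨E, rfl⟩ := CStarAlgebra.nonneg_iff_eq_star_mul_self.mp hB.1.nonneg
    obtain ⟨r, u, rfl, hu⟩ := exists_unit_multiple hv
    have h1 := hδF (C, u) ⟨hA.2, hu⟩
    have h2 := hK' (E, u) ⟨hB.2, hu⟩
    have h3 : x * F (E, u) ≤ F (C, u) := by
      refine le_trans ?_ h1
      rw [hx, div_mul_eq_mul_div, div_le_iff₀ hK1]
      exact mul_le_mul_of_nonneg_left h2 hδ.le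
    have h4 : (star ((r : ℂ) • u) ⬝ᵥ (ψ (star C * C) - (x : ℂ) • ψ (star E * E)).mulVec
        ((r : ℂ) • u)).re = r ^ 2 * (F (C, u) - x * F (E, u)) := by
      rw [star_smul, smul_dotProduct, Matrix.mulVec_smul, dotProduct_smul, Matrix.sub_mulVec,
        Matrix.smul_mulVec, dotProduct_sub, dotProduct_smul]
      simp only [smul_eq_mul, Complex.star_def, Complex.conj_ofReal, Complex.re_ofReal_mul,
        Complex.sub_re, F, Matrix.star_eq_conjTranspose]
      ring
    rw [h4]
    exact mul_nonneg (sq_nonneg r) (by linarith)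
  have hlt : (1 - x * x) / (1 + x * x) < 1 := by
    rw [div_lt_one (by positivity)]
    nlinarith
  refine lt_of_le_of_lt (ha.contractionCoeff_le fun A hA B hB => ?_) hlt
  exact projDist_le (ha.1 A hA.1) (ha.2 A hA) (ha.1 B hB.1) (ha.2 B hB) hx0.le hx0.le
    (key A hA B hB) (key B hB A hA)

end Algebra

/-! ### Semicontinuity and measurability of the contraction coefficient. -/

section Measurability

open Filter Topology

variable {D : ℕ}

/-- Upper semicontinuity: failure of `x B ≤ A` is an open condition because the cone is closed. -/
lemma eventually_mcoef_lt {P Q : Matrix (Fin D) (Fin D) ℂ} (hQ : Q.PosSemidef) (hQ0 : Q ≠ 0)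
    {x : ℝ} (hx : mcoef P Q < x) :
    ∀ᶠ p : Matrix (Fin D) (Fin D) ℂ × Matrix (Fin D) (Fin D) ℂ in 𝓝 (P, Q),
      p.1.PosSemidef → p.2.PosSemidef → p.2 ≠ 0 → mcoef p.1 p.2 < x := by
  have ho : IsOpen {p : Matrix (Fin D) (Fin D) ℂ × Matrix (Fin D) (Fin D) ℂ |
      ¬ (p.1 - (x : ℂ) • p.2).PosSemidef} :=
    (isClosed_setOf_posSemidef.preimage (f := fun p : Matrix (Fin D) (Fin D) ℂ ×
      Matrix (Fin D) (Fin D) ℂ => p.1 - (x : ℂ) • p.2) (by fun_prop)).isOpen_compl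
  have hmem : ¬ (P - (x : ℂ) • Q).PosSemidef := fun h => (le_mcoef hQ hQ0 h).not_gt hx
  filter_upwards [ho.mem_nhds hmem] with p hp h1 h2 h3
  exact lt_of_not_ge fun h => hp ((le_mcoef_iff h1 h2 h3).1 h)

/-- The projective metric is lower semicontinuous. -/
lemma eventually_lt_projDist {P Q : Matrix (Fin D) (Fin D) ℂ} (hP : P.PosSemidef) (hP0 : P ≠ 0)
    (hQ : Q.PosSemidef) (hQ0 : Q ≠ 0) {r : ℝ} (hr : r < projDist P Q) :
    ∀ᶠ p : Matrix (Fin D) (Fin D) ℂ × Matrix (Fin D) (Fin D) ℂ in 𝓝 (P, Q),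
      p.1.PosSemidef → p.1 ≠ 0 → p.2.PosSemidef → p.2 ≠ 0 → r < projDist p.1 p.2 := by
  have h1 := mcoef_nonneg hP hQ hQ0
  have h2 := mcoef_nonneg hQ hP hP0
  -- A margin by which both coefficients may grow while the distance stays above `r`.
  obtain ⟨ε, hεr, hε⟩ : ∃ ε : ℝ, r < (1 - (mcoef P Q + ε) * (mcoef Q P + ε)) /
      (1 + (mcoef P Q + ε) * (mcoef Q P + ε)) ∧ 0 < ε := by
    have hc : ContinuousAt (fun ε : ℝ => (1 - (mcoef P Q + ε) * (mcoef Q P + ε)) /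
        (1 + (mcoef P Q + ε) * (mcoef Q P + ε))) 0 := by
      refine ContinuousAt.div (by fun_prop) (by fun_prop) ?_
      simp only [add_zero]
      positivity
    have h3 : ∀ᶠ ε in 𝓝[>] (0 : ℝ), r < (1 - (mcoef P Q + ε) * (mcoef Q P + ε)) /
        (1 + (mcoef P Q + ε) * (mcoef Q P + ε)) :=
      (hc.eventually_const_lt (by simpa [projDist] using hr)).filter_mono nhdsWithin_le_nhds
    exact (h3.and self_mem_nhdsWithin).exists
  have e1 := eventually_mcoef_lt hQ hQ0 (lt_add_of_pos_right (mcoef P Q) hε)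
  have e2 := (continuous_swap.tendsto (P, Q)).eventually
    (eventually_mcoef_lt hP hP0 (lt_add_of_pos_right (mcoef Q P) hε))
  filter_upwards [e1, e2] with p g1 g2 a b c d
  refine hεr.trans_le (one_sub_div_one_add_anti (mul_nonneg (mcoef_nonneg a c d)
    (mcoef_nonneg c a b)) ?_)
  exact mul_le_mul (g1 a c d).le (g2 c a b).le (mcoef_nonneg c a b) (by positivity)

/-- For admissible maps the contraction coefficient is a supremum over countably many pairs. -/
lemma exists_seq_contractionCoeff_eq [NeZero D] : ∃ A : ℕ → Matrix (Fin D) (Fin D) ℂ,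
    (∀ i, A i ∈ states D) ∧ ∀ ψ : SuperOp D, IsAdmissible ψ →
      contractionCoeff ψ = ⨆ p : ℕ × ℕ, projDist (ψ (A p.1)) (ψ (A p.2)) := by
  have : SecondCountableTopology (Matrix (Fin D) (Fin D) ℂ) :=
    inferInstanceAs (SecondCountableTopology (Fin D → Fin D → ℂ))
  have : Nonempty (states D) := states_nonempty.to_subtype
  obtain ⟨u, hu⟩ := TopologicalSpace.exists_dense_seq (states D)
  refine ⟨fun i => u i, fun i => (u i).2, fun ψ hψ => le_antisymm ?_ ?_⟩
  · refine hψ.contractionCoeff_le fun A hA B hB => le_of_not_gt fun h => ?_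
    have hψc : Continuous ψ := LinearMap.continuous_of_finiteDimensional ψ
    -- Lower semicontinuity lets a pair exceeding the countable supremum be replaced by a pair from
    -- the dense sequence.
    have e := eventually_lt_projDist (hψ.1 A hA.1) (hψ.2 A hA) (hψ.1 B hB.1) (hψ.2 B hB) h
    have hc : Continuous fun p : states D × states D => (ψ p.1, ψ p.2) := by fun_prop
    have e' := (hc.tendsto (⟨A, hA⟩, ⟨B, hB⟩)).eventually e
    obtain ⟨p, hp⟩ := (hu.prodMap hu).exists_mem_open isOpen_interior
      ⟨_, mem_interior_iff_mem_nhds.2 e'⟩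
    have := interior_subset hp (hψ.1 _ (u p.1).2.1) (hψ.2 _ (u p.1).2) (hψ.1 _ (u p.2).2.1)
      (hψ.2 _ (u p.2).2)
    refine this.not_ge (le_ciSup (f := fun p : ℕ × ℕ => projDist (ψ (u p.1)) (ψ (u p.2)))
      ⟨1, ?_⟩ p)
    rintro _ ⟨q, rfl⟩
    exact hψ.projDist_map_le_one (u q.1).2 (u q.2).2
  · exact ciSup_le fun p => hψ.projDist_le_contractionCoeff_of_states (u p.1).2 (u p.2).2

variable {Ω : Type*} [MeasurableSpace Ω]

/-- Positivity is only guaranteed on `G`, hence the indicator. For `x > 0` a superlevel set is `G`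
intersected with the preimage of the closed cone; for `x ≤ 0` it is everything. -/
lemma measurable_indicator_mcoef {G : Set Ω} (hG : MeasurableSet G)
    {F H : Ω → Matrix (Fin D) (Fin D) ℂ} (hF : ∀ i j, Measurable fun ω => F ω i j)
    (hH : ∀ i j, Measurable fun ω => H ω i j) (hFp : ∀ ω ∈ G, (F ω).PosSemidef)
    (hHp : ∀ ω ∈ G, (H ω).PosSemidef) (hH0 : ∀ ω ∈ G, H ω ≠ 0) :
    Measurable (G.indicator fun ω => mcoef (F ω) (H ω)) := by
  refine measurable_of_Ici fun x => ?_
  rcases le_or_gt x 0 with hx | hx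
  · convert MeasurableSet.univ
    refine Set.eq_univ_of_forall fun ω => hx.trans ?_
    exact Set.indicator_nonneg (fun ω h => mcoef_nonneg (hFp ω h) (hHp ω h) (hH0 ω h)) ω
  · have hm : Measurable fun ω => (fun i j => F ω i j - x * H ω i j : Fin D → Fin D → ℂ) :=
      measurable_pi_lambda _ fun i => measurable_pi_lambda _ fun j =>
        (hF i j).sub ((hH i j).const_mul _)
    have hc : IsClosed {A : Fin D → Fin D → ℂ | Matrix.PosSemidef (Matrix.of A)} :=
      isClosed_setOf_posSemidef
    convert hG.inter (hm hc.measurableSet) using 1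
    ext ω
    by_cases hω : ω ∈ G
    · simp only [Set.mem_preimage, Set.indicator_of_mem hω, Set.mem_Ici, Set.mem_inter_iff, hω,
        true_and, le_mcoef_iff (hFp ω hω) (hHp ω hω) (hH0 ω hω)]
      rfl
    · simp [hω, hx]

lemma measurable_indicator_contractionCoeff [NeZero D] {G : Set Ω} (hG : MeasurableSet G)
    {φ : Ω → SuperOp D} (hφ : ∀ X i j, Measurable fun ω => φ ω X i j)
    (ha : ∀ ω ∈ G, IsAdmissible (φ ω)) :
    Measurable (G.indicator fun ω => contractionCoeff (φ ω)) := by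
  obtain ⟨A, hA, hc⟩ := exists_seq_contractionCoeff_eq (D := D)
  have hm : ∀ i j, Measurable (G.indicator fun ω => mcoef (φ ω (A i)) (φ ω (A j))) := fun i j =>
    measurable_indicator_mcoef hG (hφ _) (hφ _) (fun ω h => (ha ω h).1 _ (hA i).1)
      (fun ω h => (ha ω h).1 _ (hA j).1) (fun ω h => (ha ω h).2 _ (hA j))
  have hd : ∀ i j, Measurable (G.indicator fun ω => projDist (φ ω (A i)) (φ ω (A j))) := by
    intro i j
    have hmul := (hm i j).mul (hm j i)
    have h1 : Measurable (fun _ : Ω => (1 : ℝ)) := measurable_const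
    convert ((h1.sub hmul).div (h1.add hmul)).indicator hG using 1
    ext ω
    by_cases hω : ω ∈ G <;> simp [hω, projDist]
  have e : (G.indicator fun ω => contractionCoeff (φ ω)) = fun ω => ⨆ p : ℕ × ℕ,
      G.indicator (fun ω => projDist (φ ω (A p.1)) (φ ω (A p.2))) ω := by
    ext ω
    by_cases hω : ω ∈ G
    · simp [hω, hc _ (ha ω hω)]
    · simp [hω]
  rw [e]
  exact Measurable.iSup fun p => hd p.1 p.2

end Measurability

/-! ### Block-covering estimates for superadditive processes. -/

section Superadditive

open Filter Topology MeasureTheory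
open scoped ENNReal NNReal

/-- A nonnegative process `g` which is superadditive along the orbits of `T`. -/
structure IsSuperadditive {Ω : Type*} [MeasurableSpace Ω] (μ : Measure Ω) (T : Ω → Ω)
    (g : ℕ → Ω → ℝ≥0∞) : Prop where
  measurable : ∀ n, Measurable (g n)
  add_le : ∀ᵐ ω ∂μ, ∀ m n, g m ω + g n (T^[m] ω) ≤ g (m + n) ω

/-- Greedy covering of `[k, k + M)`: at each position take a good block of length at most `N`, or a
single step paid for by `b`. The uncovered tail has length at most `N` and costs `N * r`. -/
lemma superadditive_block_bound {a : ℕ → ℕ → ℝ≥0∞}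
    (ha : ∀ k m n, a k m + a (k + m) n ≤ a k (m + n)) {b : ℕ → ℝ≥0∞} {r : ℝ≥0∞} {N : ℕ}
    (hb : ∀ k, r ≤ b k ∨ ∃ n, 1 ≤ n ∧ n ≤ N ∧ n * r ≤ a k n) (M k : ℕ) :
    M * r ≤ a k M + N * r + ∑ i ∈ Finset.range M, b (k + i) := by
  induction M using Nat.strong_induction_on generalizing k with
  | _ M ih =>
    rcases le_or_gt M N with hMN | hMN
    · calc (M * r : ℝ≥0∞) ≤ N * r := by gcongr
        _ ≤ a k M + N * r := le_add_self
        _ ≤ _ := le_self_add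
    have key : ∀ n, 1 ≤ n → n ≤ M → n * r ≤ a k n + ∑ i ∈ Finset.range n, b (k + i) →
        M * r ≤ a k M + N * r + ∑ i ∈ Finset.range M, b (k + i) := by
      intro n h1 hn h
      obtain ⟨j, rfl⟩ := Nat.exists_eq_add_of_le hn
      have := ih j (by omega) (k + n)
      rw [Finset.sum_range_add]
      calc ((n + j : ℕ) * r : ℝ≥0∞) = n * r + j * r := by push_cast; ring
        _ ≤ (a k n + ∑ i ∈ Finset.range n, b (k + i)) +
            (a (k + n) j + N * r + ∑ i ∈ Finset.range j, b (k + n + i)) := add_le_add h this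
        _ = (a k n + a (k + n) j) + N * r + (∑ i ∈ Finset.range n, b (k + i) +
            ∑ i ∈ Finset.range j, b (k + (n + i))) := by
          simp only [add_assoc]
          ring
        _ ≤ _ := by gcongr; exact ha k n j
    rcases hb k with h | ⟨n, h1, hn, h⟩
    · refine key 1 le_rfl (by omega) ?_
      simpa using h.trans le_add_self
    · exact key n h1 (by omega) (h.trans le_self_add)

lemma ENNReal_le_of_forall_nat_mul_le {x y c : ℝ≥0∞} (hc : c ≠ ∞)
    (h : ∀ M : ℕ, M * x ≤ M * y + c) : x ≤ y := by
  have ht : Tendsto (fun M : ℕ => y + c / M) atTop (𝓝 (y + 0)) :=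
    tendsto_const_nhds.add (ENNReal.Tendsto.const_div ENNReal.tendsto_nat_nhds_top
      (Or.inr hc) |>.trans (by simp))
  rw [add_zero] at ht
  refine ge_of_tendsto ht ?_
  filter_upwards [eventually_gt_atTop 0] with M hM
  have hM0 : (M : ℝ≥0∞) ≠ 0 := by exact_mod_cast hM.ne'
  have hMt : (M : ℝ≥0∞) ≠ ∞ := ENNReal.natCast_ne_top M
  rw [← ENNReal.mul_le_mul_iff_right hM0 hMt, mul_add, ENNReal.mul_div_cancel hM0 hMt]
  exact h M

lemma superadditive_sum_le {Ω : Type*} {T : Ω → Ω} {g : ℕ → Ω → ℝ≥0∞} {ω : Ω}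
    (h : ∀ k m n, g m (T^[k] ω) + g n (T^[k + m] ω) ≤
    g (m + n) (T^[k] ω)) (m j : ℕ) :
    ∑ i ∈ Finset.range j, g m ((T^[m])^[i] ω) ≤ g (m * j) ω := by
  induction j with
  | zero => simp
  | succ j ih =>
    rw [Finset.sum_range_succ, ← Function.iterate_mul]
    refine (add_le_add_left ih _).trans ?_
    simpa [mul_add] using h 0 (m * j) m

variable {Ω : Type*} [MeasurableSpace Ω] {μ : Measure Ω} {T : Ω → Ω} {g : ℕ → Ω → ℝ≥0∞}

lemma ae_forall_iterate (hT : MeasurePreserving T μ μ) {p : Ω → Prop} (h : ∀ᵐ ω ∂μ, p ω) :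
    ∀ᵐ ω ∂μ, ∀ k, p (T^[k] ω) :=
  ae_all_iff.2 fun k => (hT.iterate k).quasiMeasurePreserving.ae h

/-- Maximal inequality: if almost every orbit has a block of mean at least `r`, then
`r` is at most the asymptotic mean of the process. -/
lemma IsSuperadditive.mul_measure_univ_le [IsFiniteMeasure μ] (hT : MeasurePreserving T μ μ)
    (hg : IsSuperadditive μ T g) {r : ℝ≥0} (hr : ∀ᵐ ω ∂μ, ∃ n, 1 ≤ n ∧ n * r ≤ g n ω)
    {γ : ℝ≥0∞} (hγ : ∀ m : ℕ, ∫⁻ ω, g m ω ∂μ ≤ m * γ) : r * μ Set.univ ≤ γ := by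
  -- Points with no good block of length at most `N`; their measure tends to zero as `N` grows.
  let B : ℕ → Set Ω := fun N => {ω | ∀ n, 1 ≤ n → n ≤ N → g n ω < n * r}
  have hBm : ∀ N, MeasurableSet (B N) := by
    intro N
    have : B N = ⋂ n, ⋂ (_ : 1 ≤ n), ⋂ (_ : n ≤ N), {ω | g n ω < n * r} := by
      ext ω
      simp [B]
    rw [this]
    exact MeasurableSet.iInter fun n => MeasurableSet.iInter fun _ => MeasurableSet.iInter fun _ =>
      measurableSet_lt (hg.measurable n) measurable_const
  have hB0 : Tendsto (fun N => μ (B N)) atTop (𝓝 0) := by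
    have h1 := tendsto_measure_iInter_atTop (μ := μ) (fun N => (hBm N).nullMeasurableSet)
      (fun N N' h ω hω n h1 h2 => hω n h1 (h2.trans h)) ⟨0, measure_ne_top _ _⟩
    have h2 : μ (⋂ N, B N) = 0 := by
      refine measure_mono_null ?_ (ae_iff.1 hr)
      intro ω hω
      rintro ⟨n, hn, h⟩
      exact ((Set.mem_iInter.1 hω n) n hn le_rfl).not_ge h
    rwa [h2] at h1
  have hN : ∀ N, r * μ Set.univ ≤ γ + r * μ (B N) := by
    intro N
    -- The tail error does not depend on `M`, so it disappears after dividing by `M`.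
    refine ENNReal_le_of_forall_nat_mul_le (c := N * r * μ Set.univ)
      (by finiteness) fun M => ?_
    have hpt : ∀ᵐ ω ∂μ, M * (r : ℝ≥0∞) ≤ g M ω + N * r +
        ∑ i ∈ Finset.range M, (B N).indicator (fun _ => (r : ℝ≥0∞)) (T^[i] ω) := by
      filter_upwards [ae_forall_iterate hT hg.add_le] with ω hω
      have := superadditive_block_bound (a := fun k n => g n (T^[k] ω))
        (b := fun k => (B N).indicator (fun _ => (r : ℝ≥0∞)) (T^[k] ω)) (r := r) (N := N)
        (fun k m n => by
          have := hω k m n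
          rwa [← Function.iterate_add_apply, add_comm m k] at this)
        (fun k => by
          by_cases hk : T^[k] ω ∈ B N
          · left; simp [hk]
          · right
            simp only [B, Set.mem_ofPred_eq, not_forall, not_lt] at hk
            obtain ⟨n, h1, h2, h3⟩ := hk
            exact ⟨n, h1, h2, h3⟩) M 0
      simpa using this
    have hind : Measurable ((B N).indicator (fun _ => (r : ℝ≥0∞))) :=
      measurable_const.indicator (hBm N)
    have hi : ∀ i, ∫⁻ ω, (B N).indicator (fun _ => (r : ℝ≥0∞)) (T^[i] ω) ∂μ = r * μ (B N) := by
      intro i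
      rw [(hT.iterate i).lintegral_comp hind, lintegral_indicator_const (hBm N)]
    calc M * (r * μ Set.univ) = ∫⁻ _, M * (r : ℝ≥0∞) ∂μ := by rw [lintegral_const, mul_assoc]
      _ ≤ ∫⁻ ω, (g M ω + N * r +
          ∑ i ∈ Finset.range M, (B N).indicator (fun _ => (r : ℝ≥0∞)) (T^[i] ω)) ∂μ :=
        lintegral_mono_ae hpt
      _ = ∫⁻ ω, g M ω ∂μ + N * r * μ Set.univ + M * (r * μ (B N)) := by
        rw [lintegral_add_left ((hg.measurable M).add_const _),
          lintegral_add_left (hg.measurable M), lintegral_const, lintegral_finsetSum]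
        · simp [hi]
        · exact fun i _ => hind.comp (hT.iterate i).measurable
      _ ≤ M * γ + N * r * μ Set.univ + M * (r * μ (B N)) := by gcongr; exact hγ M
      _ = M * (γ + r * μ (B N)) + N * r * μ Set.univ := by ring
  have hlim : Tendsto (fun N => γ + r * μ (B N)) atTop (𝓝 (γ + r * 0)) :=
    tendsto_const_nhds.add (ENNReal.Tendsto.const_mul hB0 (Or.inr ENNReal.coe_ne_top))
  rw [mul_zero, add_zero] at hlim
  exact ge_of_tendsto' hlim hN

/-- If almost every orbit has a block on which the mean of the bounded function `f` is at most `q`,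
then `∫ f ≤ q μ(Ω)`. -/
lemma lintegral_le_of_exists_block [IsFiniteMeasure μ] (hT : MeasurePreserving T μ μ)
    {f : Ω → ℝ≥0∞} (hf : Measurable f) {K q : ℝ≥0} (hfK : ∀ ω, f ω ≤ K)
    (hq : ∀ᵐ ω ∂μ, ∃ n, 1 ≤ n ∧ ∑ i ∈ Finset.range n, f (T^[i] ω) ≤ n * q) :
    ∫⁻ ω, f ω ∂μ ≤ q * μ Set.univ := by
  rcases le_total K q with hKq | hqK
  · calc ∫⁻ ω, f ω ∂μ ≤ ∫⁻ _, (q : ℝ≥0∞) ∂μ :=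
        lintegral_mono fun ω => (hfK ω).trans (by exact_mod_cast hKq)
      _ = _ := lintegral_const _
  have hsum : ∀ ω, f ω + (K - f ω) = K := fun ω => add_tsub_cancel_of_le (hfK ω)
  have hKf : Measurable fun ω => (K : ℝ≥0∞) - f ω := measurable_const.sub hf
  -- Reflection: a block where `f` has mean at most `q` is one where `K - f` has mean at least `K -
  -- q`, so the maximal inequality applies to the additive process of `K - f`.
  have hadd : IsSuperadditive μ T fun n ω => ∑ i ∈ Finset.range n, ((K : ℝ≥0∞) - f (T^[i] ω)) := by
    refine ⟨fun n => Finset.measurable_sum _ fun i _ => hKf.comp (hT.iterate i).measurable,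
      Eventually.of_forall fun ω m n => ?_⟩
    rw [Finset.sum_range_add]
    simp only [← Function.iterate_add_apply, add_comm m, le_refl]
  have h1 := hadd.mul_measure_univ_le hT (r := K - q) (γ := ∫⁻ ω, (K - f ω) ∂μ) (by
      filter_upwards [hq] with ω ⟨n, hn, h⟩
      refine ⟨n, hn, ?_⟩
      have e : ∑ i ∈ Finset.range n, f (T^[i] ω) +
          ∑ i ∈ Finset.range n, ((K : ℝ≥0∞) - f (T^[i] ω)) = n * K := by
        rw [← Finset.sum_add_distrib]
        simp [hsum]
      rw [ENNReal.coe_sub, ENNReal.mul_sub (by simp), tsub_le_iff_left, ← e]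
      gcongr) (fun m => by
      have hc : ∀ i, Measurable fun ω => (K : ℝ≥0∞) - f (T^[i] ω) :=
        fun i => hKf.comp (hT.iterate i).measurable
      rw [lintegral_finsetSum _ fun i _ => hc i]
      simp [fun i => (hT.iterate i).lintegral_comp hKf])
  have h2 : ∫⁻ ω, f ω ∂μ + ∫⁻ ω, (K - f ω) ∂μ = K * μ Set.univ := by
    rw [← lintegral_add_left hf]
    simp [hsum]
  have h3 : (K : ℝ≥0∞) * μ Set.univ = q * μ Set.univ + (K - q : ℝ≥0) * μ Set.univ := by
    rw [← add_mul]
    norm_cast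
    rw [add_tsub_cancel_of_le hqK]
  rw [← ENNReal.add_le_add_iff_right (a := (K - q : ℝ≥0) * μ Set.univ) (by finiteness), ← h3, ← h2]
  gcongr

lemma IsSuperadditive.ae_orbit (hT : MeasurePreserving T μ μ) (hg : IsSuperadditive μ T g) :
    ∀ᵐ ω ∂μ, ∀ k m n, g m (T^[k] ω) + g n (T^[k + m] ω) ≤ g (m + n) (T^[k] ω) := by
  filter_upwards [ae_forall_iterate hT hg.add_le] with ω hω k m n
  have := hω k m n
  rwa [← Function.iterate_add_apply, add_comm m k] at this

/-- If `g n ω ≤ n q`, superadditivity gives the same bound for the sum of `g m` over the `n / m`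
disjoint blocks of length `m`. This is a small block mean for `T^[m]`; the truncation at `K`
supplies boundedness and is removed by monotone convergence. -/
lemma IsSuperadditive.lintegral_le [IsFiniteMeasure μ] (hT : MeasurePreserving T μ μ)
    (hg : IsSuperadditive μ T g) {q q' : ℝ≥0} (hqq : q < q')
    (hq : ∀ᵐ ω ∂μ, ∃ᶠ n in atTop, g n ω ≤ n * q) (m : ℕ) :
    ∫⁻ ω, g m ω ∂μ ≤ m * (q' * μ Set.univ) := by
  rcases Nat.eq_zero_or_pos m with rfl | hm
  -- `g 0 + g n ≤ g n` with `g n` finite leaves only `g 0 = 0`.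
  · have h0 : ∀ᵐ ω ∂μ, g 0 ω = 0 := by
      filter_upwards [hg.ae_orbit hT, hq] with ω h h'
      obtain ⟨n, hn⟩ := h'.exists
      have hfin : g n ω ≠ ∞ := ne_top_of_le_ne_top (by finiteness) hn
      have := h 0 0 n
      simp only [Function.iterate_zero, id_eq, zero_add] at this
      have := ENNReal.le_of_add_le_add_right hfin (this.trans_eq (zero_add _).symm)
      exact nonpos_iff_eq_zero.1 this
    rw [lintegral_congr_ae h0]
    simp
  have hK : ∀ K : ℕ, ∫⁻ ω, min (g m ω) K ∂μ ≤ m * (q' * μ Set.univ) := by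
    intro K
    have := lintegral_le_of_exists_block (hT.iterate m) ((hg.measurable m).min measurable_const)
      (f := fun ω => min (g m ω) K) (K := K) (q := m * q') (fun ω => by simp) (by
        filter_upwards [hg.ae_orbit hT, hq] with ω h hfr
        -- The gap `q < q'` absorbs the incomplete last block: `n < m (j + 1)` with `j = n / m`, and
        -- `j` is large.
        obtain ⟨N, hN⟩ : ∃ N : ℕ, ∀ j, N ≤ j → ((j : ℝ≥0) + 1) * q ≤ j * q' := by
          obtain ⟨N, hN⟩ := exists_nat_gt (q / (q' - q))
          have hd : 0 < q' - q := tsub_pos_of_lt hqq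
          refine ⟨N, fun j hj => ?_⟩
          have h1 : q ≤ j * (q' - q) := by
            rw [div_lt_iff₀ hd] at hN
            exact hN.le.trans (by gcongr)
          calc ((j : ℝ≥0) + 1) * q = j * q + q := by ring
            _ ≤ j * q + j * (q' - q) := by gcongr
            _ = j * q' := by rw [← mul_add, add_tsub_cancel_of_le hqq.le]
        obtain ⟨n, hn, hgn⟩ := (frequently_atTop.1 hfr) (m * (N + 1))
        have hj : N + 1 ≤ n / m := (Nat.le_div_iff_mul_le hm).2 (by rwa [mul_comm])
        refine ⟨n / m, by omega, ?_⟩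
        calc ∑ i ∈ Finset.range (n / m), min (g m ((T^[m])^[i] ω)) K
            ≤ ∑ i ∈ Finset.range (n / m), g m ((T^[m])^[i] ω) :=
              Finset.sum_le_sum fun i _ => min_le_left _ _
          _ ≤ g (m * (n / m)) ω := superadditive_sum_le h m _
          _ ≤ g n ω := by
              have := h 0 (m * (n / m)) (n % m)
              rw [Nat.div_add_mod] at this
              exact le_self_add.trans (by simpa using this)
          _ ≤ n * q := hgn
          _ ≤ (n / m : ℕ) * (m * q' : ℝ≥0) := by
              have h1 : (n : ℝ≥0) * q ≤ (n / m : ℕ) * (m * q') := by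
                have h2 : (n : ℝ≥0) ≤ m * ((n / m : ℕ) + 1) := by
                  exact_mod_cast (Nat.lt_mul_div_succ n hm).le
                calc (n : ℝ≥0) * q ≤ m * ((n / m : ℕ) + 1) * q := by gcongr
                  _ = m * ((((n / m : ℕ) : ℝ≥0) + 1) * q) := by ring
                  _ ≤ m * ((n / m : ℕ) * q') := by gcongr m * ?_; exact hN _ (by omega)
                  _ = _ := by ring
              exact_mod_cast h1)
    rw [ENNReal.coe_mul, mul_assoc] at this
    exact_mod_cast this
  have hlim : ∫⁻ ω, g m ω ∂μ = ⨆ K : ℕ, ∫⁻ ω, min (g m ω) K ∂μ := by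
    rw [← lintegral_iSup (fun K => (hg.measurable m).min measurable_const)]
    · congr 1 with ω
      rw [← inf_iSup_eq, ENNReal.iSup_natCast, inf_top_eq]
    · intro K K' h ω
      exact min_le_min_left _ (by exact_mod_cast h)
  rw [hlim]
  exact iSup_le hK

end Superadditive

/-! ### Growth rates and the ergodic theorem. -/

section Superadditive

open Filter Topology MeasureTheory
open scoped ENNReal NNReal

lemma tendsto_add_div_natCast (k : ℕ) :
    Tendsto (fun n : ℕ => ((n + k : ℕ) : ℝ≥0∞) / n) atTop (𝓝 1) := by
  have h : Tendsto (fun n : ℕ => (1 : ℝ≥0∞) + k / n) atTop (𝓝 (1 + 0)) :=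
    tendsto_const_nhds.add (ENNReal.Tendsto.const_div ENNReal.tendsto_nat_nhds_top
      (Or.inr (ENNReal.natCast_ne_top k)) |>.trans (by simp))
  rw [add_zero] at h
  refine h.congr' ?_
  filter_upwards [eventually_gt_atTop 0] with n hn
  have hn0 : (n : ℝ≥0∞) ≠ 0 := by exact_mod_cast hn.ne'
  rw [Nat.cast_add, ENNReal.add_div, ENNReal.div_self hn0 (ENNReal.natCast_ne_top n)]

lemma div_le_shift {a b : ℕ → ℝ≥0∞} {k n : ℕ} (hn : 0 < n) (h : a n ≤ b (n + k)) :
    a n / n ≤ ((n + k : ℕ) : ℝ≥0∞) / n * (b (n + k) / (n + k : ℕ)) := by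
  have h0 : ((n + k : ℕ) : ℝ≥0∞) ≠ 0 := by
    exact_mod_cast (by omega : n + k ≠ 0)
  have e : ((n + k : ℕ) : ℝ≥0∞) / n * (b (n + k) / (n + k : ℕ)) = b (n + k) / n := by
    simp only [div_eq_mul_inv]
    calc ((n + k : ℕ) : ℝ≥0∞) * (n : ℝ≥0∞)⁻¹ * (b (n + k) * ((n + k : ℕ) : ℝ≥0∞)⁻¹)
        = (((n + k : ℕ) : ℝ≥0∞) * ((n + k : ℕ) : ℝ≥0∞)⁻¹) * (b (n + k) * (n : ℝ≥0∞)⁻¹) := by ring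
      _ = _ := by rw [ENNReal.mul_inv_cancel h0 (ENNReal.natCast_ne_top _), one_mul]
  rw [e]
  gcongr

/-- Delaying the index by `k` changes the mean only by the factor `(n + k) / n`, which tends to one.
-/
lemma liminf_div_le_of_shift {a b : ℕ → ℝ≥0∞} {k : ℕ} (h : ∀ n, a n ≤ b (n + k)) :
    liminf (fun n : ℕ => a n / n) atTop ≤ liminf (fun n : ℕ => b n / n) atTop := by
  have h1 := tendsto_add_div_natCast k
  calc liminf (fun n : ℕ => a n / n) atTop
      ≤ liminf ((fun n : ℕ => ((n + k : ℕ) : ℝ≥0∞) / n) * fun n => b (n + k) / (n + k : ℕ)) atTop :=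
        liminf_le_liminf ((eventually_gt_atTop 0).mono fun n hn => div_le_shift hn (h n))
    _ ≤ limsup (fun n : ℕ => ((n + k : ℕ) : ℝ≥0∞) / n) atTop *
          liminf (fun n => b (n + k) / (n + k : ℕ)) atTop := by
        apply ENNReal.liminf_mul_le <;> rw [h1.limsup_eq] <;> simp
    _ = _ := by
        rw [h1.limsup_eq, one_mul, liminf_nat_add (fun n : ℕ => b n / n) k]

lemma limsup_div_le_of_shift {a b : ℕ → ℝ≥0∞} {k : ℕ} (h : ∀ n, a n ≤ b (n + k)) :
    limsup (fun n : ℕ => a n / n) atTop ≤ limsup (fun n : ℕ => b n / n) atTop := by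
  have h1 := tendsto_add_div_natCast k
  calc limsup (fun n : ℕ => a n / n) atTop
      ≤ limsup ((fun n : ℕ => ((n + k : ℕ) : ℝ≥0∞) / n) * fun n => b (n + k) / (n + k : ℕ)) atTop :=
        limsup_le_limsup ((eventually_gt_atTop 0).mono fun n hn => div_le_shift hn (h n))
    _ ≤ limsup (fun n : ℕ => ((n + k : ℕ) : ℝ≥0∞) / n) atTop *
          limsup (fun n => b (n + k) / (n + k : ℕ)) atTop := by
        apply ENNReal.limsup_mul_le' <;> rw [h1.limsup_eq] <;> simp
    _ = _ := by
        rw [h1.limsup_eq, one_mul, limsup_nat_add (fun n : ℕ => b n / n) k]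

/-- For monotone functions the linear growth rate along the integers is that along the reals. -/
lemma tendsto_div_real_of_nat {G : ℝ → ℝ≥0∞} (hG : ∀ s t, 0 < s → s ≤ t → G s ≤ G t) {l : ℝ≥0∞}
    (h : Tendsto (fun n : ℕ => G n / n) atTop (𝓝 l)) :
    Tendsto (fun t : ℝ => G t / ENNReal.ofReal t) atTop (𝓝 l) := by
  have hfl : Tendsto (fun t : ℝ => ⌊t⌋₊) atTop atTop := tendsto_nat_floor_atTop
  have hr1 : Tendsto (fun t : ℝ => ENNReal.ofReal (⌊t⌋₊ / t)) atTop (𝓝 1) := by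
    simpa using ENNReal.tendsto_ofReal (tendsto_nat_floor_div_atTop (R := ℝ))
  have hr2 : Tendsto (fun t : ℝ => ENNReal.ofReal ((⌊t⌋₊ + 1 : ℕ) / t)) atTop (𝓝 1) := by
    have := (tendsto_nat_floor_div_atTop (R := ℝ)).add (tendsto_inv_atTop_zero (𝕜 := ℝ))
    rw [add_zero] at this
    have := ENNReal.tendsto_ofReal this
    rw [ENNReal.ofReal_one] at this
    refine this.congr fun t => ?_
    congr 1
    push_cast
    ring
  have lo := ENNReal.Tendsto.mul (h.comp hfl) (Or.inr ENNReal.one_ne_top) hr1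
    (Or.inl one_ne_zero)
  have hi := ENNReal.Tendsto.mul (h.comp ((tendsto_add_atTop_nat 1).comp hfl))
    (Or.inr ENNReal.one_ne_top) hr2 (Or.inl one_ne_zero)
  rw [mul_one] at lo hi
  have key : ∀ (n : ℕ) (t : ℝ), 0 < n → 0 < t →
      G n / n * ENNReal.ofReal (n / t) = G n / ENNReal.ofReal t := by
    intro n t hn ht
    have hn0 : (n : ℝ≥0∞) ≠ 0 := by exact_mod_cast hn.ne'
    rw [ENNReal.ofReal_div_of_pos ht, ENNReal.ofReal_natCast, ← mul_div_assoc,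
      ENNReal.div_mul_cancel hn0 (ENNReal.natCast_ne_top n)]
  refine tendsto_of_tendsto_of_tendsto_of_le_of_le' lo hi ?_ ?_
  · filter_upwards [eventually_ge_atTop 1] with t ht
    have hp : 0 < ⌊t⌋₊ := Nat.floor_pos.2 ht
    simp only [Function.comp_apply]
    rw [key _ _ hp (by linarith)]
    gcongr
    exact hG _ _ (by exact_mod_cast hp) (Nat.floor_le (by linarith))
  · filter_upwards [eventually_ge_atTop 1] with t ht
    simp only [Function.comp_apply]
    rw [key _ _ (by omega) (by linarith)]
    gcongr
    exact hG _ _ (by linarith) (by exact_mod_cast (Nat.lt_floor_add_one t).le)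

variable {Ω : Type*} [MeasurableSpace Ω] {μ : Measure Ω} {T S : Ω → Ω} {g g' : ℕ → Ω → ℝ≥0∞}

/-- A function which does not increase along a measure-preserving map is invariant. -/
lemma ae_comp_eq_of_ae_comp_le [IsFiniteMeasure μ] (hT : MeasurePreserving T μ μ) {F : Ω → ℝ≥0∞}
    (hF : Measurable F) (h : ∀ᵐ ω ∂μ, F (T ω) ≤ F ω) : ∀ᵐ ω ∂μ, F (T ω) = F ω := by
  -- `F` may be infinite or non-integrable. The injective decreasing transform `(1 + F)⁻¹` is
  -- bounded, and ordered functions with equal finite integrals agree almost everywhere.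
  have hm : Measurable fun ω => (1 + F ω)⁻¹ := (measurable_const.add hF).inv
  have hle : (fun ω => (1 + F ω)⁻¹) ≤ᵐ[μ] fun ω => (1 + F (T ω))⁻¹ := by
    filter_upwards [h] with ω hω
    exact ENNReal.inv_le_inv.2 (by gcongr)
  have hfin : ∫⁻ ω, (1 + F ω)⁻¹ ∂μ ≠ ∞ := by
    refine ne_top_of_le_ne_top (measure_ne_top μ Set.univ) ?_
    rw [← lintegral_one]
    exact lintegral_mono fun ω => ENNReal.inv_le_one.2 le_self_add
  have := ae_eq_of_ae_le_of_lintegral_le hle hfin (hm.comp hT.measurable).aemeasurable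
    (hT.lintegral_comp hm).le
  filter_upwards [this] with ω hω
  have := inv_injective hω
  exact ((ENNReal.add_right_inj ENNReal.one_ne_top).1 this).symm

lemma IsSuperadditive.measurable_liminf (hg : IsSuperadditive μ T g) :
    Measurable fun ω => liminf (fun n : ℕ => g n ω / n) atTop :=
  Measurable.liminf fun n => (hg.measurable n).div_const _

lemma IsSuperadditive.measurable_limsup (hg : IsSuperadditive μ T g) :
    Measurable fun ω => limsup (fun n : ℕ => g n ω / n) atTop :=
  Measurable.limsup fun n => (hg.measurable n).div_const _

lemma IsSuperadditive.le_succ (hg : IsSuperadditive μ T g) :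
    ∀ᵐ ω ∂μ, ∀ n, g n (T ω) ≤ g (n + 1) ω := by
  filter_upwards [hg.add_le] with ω h n
  have := h 1 n
  rw [add_comm 1 n] at this
  exact le_add_self.trans this

lemma IsSuperadditive.liminf_invariant [IsFiniteMeasure μ] (hT : MeasurePreserving T μ μ)
    (hg : IsSuperadditive μ T g) : ∀ᵐ ω ∂μ,
      liminf (fun n : ℕ => g n (T ω) / n) atTop = liminf (fun n : ℕ => g n ω / n) atTop :=
  ae_comp_eq_of_ae_comp_le hT hg.measurable_liminf
    (hg.le_succ.mono fun _ h => liminf_div_le_of_shift h)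

lemma IsSuperadditive.limsup_invariant [IsFiniteMeasure μ] (hT : MeasurePreserving T μ μ)
    (hg : IsSuperadditive μ T g) : ∀ᵐ ω ∂μ,
      limsup (fun n : ℕ => g n (T ω) / n) atTop = limsup (fun n : ℕ => g n ω / n) atTop :=
  ae_comp_eq_of_ae_comp_le hT hg.measurable_limsup
    (hg.le_succ.mono fun _ h => limsup_div_le_of_shift h)

lemma IsSuperadditive.mono_measure (hg : IsSuperadditive μ T g) {ν : Measure Ω}
    (h : ν ≪ μ) : IsSuperadditive ν T g :=
  ⟨hg.measurable, h.ae_le hg.add_le⟩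

lemma measurePreserving_restrict_of_invariant (hT : MeasurePreserving T μ μ) {A : Set Ω}
    (hA : MeasurableSet A) (hinv : ∀ᵐ ω ∂μ, T ω ∈ A ↔ ω ∈ A) :
    MeasurePreserving T (μ.restrict A) (μ.restrict A) := by
  have := hT.restrict_preimage hA
  rwa [Measure.restrict_congr_set (s := T ⁻¹' A) (t := A) (hinv.mono fun ω h => propext h)] at this

/-- For `q < q' < r`, let `A` be the event that the liminf is below `q` and the limsup above `r`. It
is invariant under both maps. There `∫ g m ≤ m q' μ(A)`, and `g' m` has the same integral, so the
maximal inequality yields `r μ(A) ≤ q' μ(A)`, hence `μ(A) = 0`. -/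
lemma IsSuperadditive.limsup_le_liminf_of_inverse [IsFiniteMeasure μ]
    (hT : MeasurePreserving T μ μ) (hS : MeasurePreserving S μ μ) (hTS : Function.LeftInverse T S)
    (hST : Function.LeftInverse S T) (hg : IsSuperadditive μ T g) (hg' : IsSuperadditive μ S g')
    (hgg : ∀ n, ∀ᵐ ω ∂μ, g' n ω = g n (S^[n] ω)) : ∀ᵐ ω ∂μ,
      limsup (fun n : ℕ => g' n ω / n) atTop ≤ liminf (fun n : ℕ => g n ω / n) atTop := by
  have hL := hg.measurable_liminf
  have hU := hg'.measurable_limsup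
  have hLT := hg.liminf_invariant hT
  have hUS := hg'.limsup_invariant hS
  have hLS : ∀ᵐ ω ∂μ, liminf (fun n : ℕ => g n (S ω) / n) atTop =
      liminf (fun n : ℕ => g n ω / n) atTop := by
    filter_upwards [hS.quasiMeasurePreserving.ae hLT] with ω h
    rw [hTS ω] at h
    exact h.symm
  have hUT : ∀ᵐ ω ∂μ, limsup (fun n : ℕ => g' n (T ω) / n) atTop =
      limsup (fun n : ℕ => g' n ω / n) atTop := by
    filter_upwards [hT.quasiMeasurePreserving.ae hUS] with ω h
    rw [hST ω] at h
    exact h.symm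
  have main : ∀ q r : ℝ≥0, q < r → ∀ᵐ ω ∂μ, ¬ (liminf (fun n : ℕ => g n ω / n) atTop < q ∧
      r < limsup (fun n : ℕ => g' n ω / n) atTop) := by
    intro q r hqr
    let A : Set Ω := {ω | liminf (fun n : ℕ => g n ω / n) atTop < q ∧
      r < limsup (fun n : ℕ => g' n ω / n) atTop}
    have hA : MeasurableSet A :=
      (measurableSet_lt hL measurable_const).inter (measurableSet_lt measurable_const hU)
    have hAT := measurePreserving_restrict_of_invariant hT hA (by
      filter_upwards [hLT, hUT] with ω h1 h2
      simp only [A, Set.mem_ofPred_eq, h1, h2])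
    have hAS := measurePreserving_restrict_of_invariant hS hA (by
      filter_upwards [hLS, hUS] with ω h1 h2
      simp only [A, Set.mem_ofPred_eq, h1, h2])
    have hac : μ.restrict A ≪ μ := Measure.absolutelyContinuous_of_le Measure.restrict_le_self
    obtain ⟨q', h1, h2⟩ := exists_between hqr
    have hup := (hg.mono_measure hac).lintegral_le hAT h1 (by
      filter_upwards [ae_restrict_mem hA] with ω hω
      refine ((frequently_lt_of_liminf_lt (by isBoundedDefault) hω.1).and_eventually
        (eventually_gt_atTop 0)).mono fun n hn => ?_
      have hn0 : (n : ℝ≥0∞) ≠ 0 := by exact_mod_cast hn.2.ne'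
      rw [ENNReal.div_lt_iff (Or.inl hn0) (Or.inl (ENNReal.natCast_ne_top n)), mul_comm] at hn
      exact hn.1.le)
    have hlow := (hg'.mono_measure hac).mul_measure_univ_le hAS (r := r)
      (γ := q' * (μ.restrict A) Set.univ) (by
        filter_upwards [ae_restrict_mem hA] with ω hω
        obtain ⟨n, hn, hn1⟩ := ((frequently_lt_of_lt_limsup (by isBoundedDefault)
          hω.2).and_eventually (eventually_gt_atTop 0)).exists
        have hn0 : (n : ℝ≥0∞) ≠ 0 := by exact_mod_cast hn1.ne'
        rw [ENNReal.lt_div_iff_mul_lt (Or.inl hn0) (Or.inl (ENNReal.natCast_ne_top n)),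
          mul_comm] at hn
        exact ⟨n, hn1, hn.le⟩) (fun m => by
        refine le_trans (le_of_eq ?_) (hup m)
        rw [lintegral_congr_ae (hac.ae_le (hgg m)),
          (hAS.iterate m).lintegral_comp (hg.measurable m)])
    have h0 : μ A = 0 := by
      by_contra hne
      rw [Measure.restrict_apply_univ, ENNReal.mul_le_mul_iff_left hne (measure_ne_top μ A)] at hlow
      exact absurd hlow (not_le.2 (by exact_mod_cast h2))
    exact measure_eq_zero_iff_ae_notMem.1 h0
  have main' : ∀ᵐ ω ∂μ, ∀ q r : ℚ, Real.toNNReal q < Real.toNNReal r →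
      ¬ (liminf (fun n : ℕ => g n ω / n) atTop < Real.toNNReal q ∧
      Real.toNNReal r < limsup (fun n : ℕ => g' n ω / n) atTop) := by
    rw [ae_all_iff]; intro q
    rw [ae_all_iff]; intro r
    by_cases h : Real.toNNReal q < Real.toNNReal r
    · filter_upwards [main _ _ h] with ω hω _ using hω
    · exact Eventually.of_forall fun ω h' => absurd h' h
  filter_upwards [main'] with ω hω
  by_contra! hlt
  obtain ⟨q, -, hq1, hq2⟩ := ENNReal.lt_iff_exists_rat_btwn.1 hlt
  obtain ⟨r, -, hr1, hr2⟩ := ENNReal.lt_iff_exists_rat_btwn.1 hq2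
  exact hω q r (by exact_mod_cast hr1) ⟨hq1, hr2⟩

/-- **Subadditive ergodic theorem** for a nonnegative superadditive process over an invertible map,
together with the equality of the forward and the backward limits. -/
theorem IsSuperadditive.tendsto_of_inverse [IsFiniteMeasure μ]
    (hT : MeasurePreserving T μ μ) (hS : MeasurePreserving S μ μ) (hTS : Function.LeftInverse T S)
    (hST : Function.LeftInverse S T) (hg : IsSuperadditive μ T g) (hg' : IsSuperadditive μ S g')
    (hgg : ∀ n, ∀ᵐ ω ∂μ, g' n ω = g n (S^[n] ω)) : ∀ᵐ ω ∂μ,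
      Tendsto (fun n : ℕ => g n ω / n) atTop (𝓝 (liminf (fun n : ℕ => g n ω / n) atTop)) ∧
      Tendsto (fun n : ℕ => g' n ω / n) atTop (𝓝 (liminf (fun n : ℕ => g n ω / n) atTop)) := by
  have hgg' : ∀ n, ∀ᵐ ω ∂μ, g n ω = g' n (T^[n] ω) := by
    intro n
    filter_upwards [(hT.iterate n).quasiMeasurePreserving.ae (hgg n)] with ω h
    rw [h, hST.iterate n ω]
  -- Used in both time directions, the comparison closes a cycle of inequalities through the two
  -- liminfs and limsups, making all four equal.
  filter_upwards [hg.limsup_le_liminf_of_inverse hT hS hTS hST hg' hgg,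
    hg'.limsup_le_liminf_of_inverse hS hT hST hTS hg hgg'] with ω h1 h2
  have h3 : liminf (fun n : ℕ => g n ω / n) atTop ≤ limsup (fun n : ℕ => g n ω / n) atTop :=
    liminf_le_limsup
  have h4 : liminf (fun n : ℕ => g' n ω / n) atTop ≤ limsup (fun n : ℕ => g' n ω / n) atTop :=
    liminf_le_limsup
  exact ⟨tendsto_of_liminf_eq_limsup rfl (le_antisymm (h2.trans (h4.trans h1)) h3),
    tendsto_of_liminf_eq_limsup (le_antisymm (h4.trans h1) (h3.trans h2))
      (le_antisymm h1 (h3.trans (h2.trans h4)))⟩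

/-- Where the growth rate vanishes, the process vanishes. -/
lemma IsSuperadditive.eq_zero_of_liminf_eq_zero [IsFiniteMeasure μ] (hT : MeasurePreserving T μ μ)
    (hg : IsSuperadditive μ T g) : ∀ᵐ ω ∂μ,
      liminf (fun n : ℕ => g n ω / n) atTop = 0 → ∀ m, g m ω = 0 := by
  let A : Set Ω := {ω | liminf (fun n : ℕ => g n ω / n) atTop = 0}
  have hA : MeasurableSet A := hg.measurable_liminf (measurableSet_singleton 0)
  have hAT := measurePreserving_restrict_of_invariant hT hA (by
    filter_upwards [hg.liminf_invariant hT] with ω h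
    simp only [A, Set.mem_ofPred_eq, h])
  have hac : μ.restrict A ≪ μ := Measure.absolutelyContinuous_of_le Measure.restrict_le_self
  have h0 : ∀ m, ∫⁻ ω, g m ω ∂(μ.restrict A) = 0 := by
    intro m
    -- A zero liminf allows every positive slope in the upper integral bound; letting the slope tend
    -- to zero kills the integral.
    have hq : ∀ q' : ℝ≥0, 0 < q' → ∫⁻ ω, g m ω ∂(μ.restrict A) ≤
        q' * (m * (μ.restrict A) Set.univ) := by
      intro q' hq'
      obtain ⟨q, h1, h2⟩ := exists_between hq'
      have := (hg.mono_measure hac).lintegral_le hAT h2 (by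
        filter_upwards [ae_restrict_mem hA] with ω hω
        have hlt : liminf (fun n : ℕ => g n ω / n) atTop < q := by
          rw [show liminf (fun n : ℕ => g n ω / n) atTop = 0 from hω]
          exact_mod_cast h1
        refine ((frequently_lt_of_liminf_lt (by isBoundedDefault) hlt).and_eventually
          (eventually_gt_atTop 0)).mono fun n hn => ?_
        have hn0 : (n : ℝ≥0∞) ≠ 0 := by exact_mod_cast hn.2.ne'
        rw [ENNReal.div_lt_iff (Or.inl hn0) (Or.inl (ENNReal.natCast_ne_top n)), mul_comm] at hn
        exact hn.1.le) m
      rwa [mul_left_comm] at this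
    have hlim : Tendsto (fun q' : ℝ≥0 => (q' : ℝ≥0∞) * (m * (μ.restrict A) Set.univ)) (𝓝[>] 0)
        (𝓝 ((0 : ℝ≥0) * (m * (μ.restrict A) Set.univ))) :=
      ENNReal.Tendsto.mul_const ((ENNReal.tendsto_coe.2 tendsto_id).mono_left nhdsWithin_le_nhds)
        (Or.inr (by finiteness))
    rw [ENNReal.coe_zero, zero_mul] at hlim
    exact nonpos_iff_eq_zero.1 (ge_of_tendsto hlim (by
      filter_upwards [self_mem_nhdsWithin] with q hq' using hq q hq'))
  have h1 : ∀ᵐ ω ∂(μ.restrict A), ∀ m, g m ω = 0 :=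
    ae_all_iff.2 fun m => (lintegral_eq_zero_iff (hg.measurable m)).1 (h0 m)
  exact (ae_restrict_iff' hA).1 h1

end Superadditive

/-! ### Negative logarithms with values in `[0, ∞]`. -/

section NegLn

open Filter Topology
open scoped ENNReal

/-- `-ln c` as an extended nonnegative real. -/
noncomputable def negLn (c : ℝ) : ℝ≥0∞ := (-ln c).toENNReal

lemma ln_le_zero {c : ℝ} (hc : c ≤ 1) : ln c ≤ 0 :=
  ENNReal.log_le_zero_iff.2 (ENNReal.ofReal_le_one.2 hc)

lemma negLn_anti : Antitone negLn := fun _ _ h =>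
  EReal.toENNReal_le_toENNReal (EReal.neg_le_neg_iff.2
    (ENNReal.log_monotone (ENNReal.ofReal_le_ofReal h)))

lemma negLn_mul {a b : ℝ} (ha0 : 0 ≤ a) (ha : a ≤ 1) (hb : b ≤ 1) :
    negLn (a * b) = negLn a + negLn b := by
  have h1 := ln_le_zero ha
  have h2 := ln_le_zero hb
  have e : ln (a * b) = ln a + ln b := by
    rw [ln, ENNReal.ofReal_mul ha0, ENNReal.log_mul_add]
    rfl
  rw [negLn, e, EReal.neg_add (Or.inr (ne_top_of_le_ne_top EReal.zero_ne_top h2))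
    (Or.inl (ne_top_of_le_ne_top EReal.zero_ne_top h1)), sub_eq_add_neg,
    EReal.toENNReal_add (EReal.neg_nonneg.2 h1) (EReal.neg_nonneg.2 h2)]
  rfl

lemma negLn_pos {c : ℝ} (hc : c < 1) : 0 < negLn c := by
  rw [negLn, EReal.toENNReal_pos_iff, ln, EReal.neg_pos]
  exact ENNReal.log_lt_zero_iff.2 (ENNReal.ofReal_lt_one.2 hc)

lemma measurable_negLn : Measurable negLn := by
  unfold negLn ln
  fun_prop

/-- Translates the `EReal` expression of the theorem into the `[0, ∞]`-valued mean handled by the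
ergodic theorem, including the value `-∞` at `c ≤ 0`. -/
lemma inv_mul_ln_eq {c t : ℝ} (hc : c ≤ 1) (ht : 0 < t) :
    ((1 / t : ℝ) : EReal) * ln c = -((negLn c / ENNReal.ofReal t : ℝ≥0∞) : EReal) := by
  rcases le_or_gt c 0 with h | h
  · have hl : ln c = ⊥ := by simp [ln, ENNReal.ofReal_of_nonpos h]
    rw [negLn, hl, EReal.coe_mul_bot_of_pos (by positivity), EReal.neg_bot, EReal.toENNReal_top,
      ENNReal.top_div_of_ne_top ENNReal.ofReal_ne_top]
    rfl
  · have hl : ln c = (Real.log c : EReal) := ENNReal.log_ofReal_of_pos h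
    have hlog : Real.log c ≤ 0 := Real.log_nonpos h.le hc
    have hn : negLn c = ENNReal.ofReal (-Real.log c) := by
      rw [negLn, hl, ← EReal.coe_neg, EReal.toENNReal_of_ne_top (EReal.coe_ne_top _),
        EReal.toReal_coe]
    rw [hn, hl, ← ENNReal.ofReal_div_of_pos ht, EReal.coe_ennreal_ofReal,
      max_eq_left (div_nonneg (by linarith) ht.le)]
    norm_cast
    field_simp

end NegLn

/-! ### Superadditivity and monotonicity of decay along a propagator. -/

section Propagator

open Filter Topology MeasureTheory
open scoped ENNReal

variable {D : ℕ} [NeZero D]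

/-- A deterministic propagator of positive maps which annihilate no state. -/
structure IsAdmissiblePropagator (φ : ℝ → ℝ → SuperOp D) : Prop where
  admissible : ∀ s t : ℝ, s < t → IsAdmissible (φ s t)
  propagate : ∀ s r t : ℝ, s < r → r < t → φ s t = φ r t ∘ₗ φ s r

/-- `-ln c(φ)` for a super-operator `φ`. -/
noncomputable def decay (ψ : SuperOp D) : ℝ≥0∞ := negLn (contractionCoeff ψ)

variable {φ : ℝ → ℝ → SuperOp D}

lemma IsAdmissiblePropagator.decay_add_le (hφ : IsAdmissiblePropagator φ) {s r t : ℝ} (h1 : s < r)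
    (h2 : r < t) : decay (φ s r) + decay (φ r t) ≤ decay (φ s t) := by
  have a1 := hφ.admissible s r h1
  have a2 := hφ.admissible r t h2
  rw [add_comm, decay, decay, ← negLn_mul a2.contractionCoeff_nonneg a2.contractionCoeff_le_one
    a1.contractionCoeff_le_one, hφ.propagate s r t h1 h2]
  exact negLn_anti (contractionCoeff_comp_le a2 a1)

lemma IsAdmissiblePropagator.decay_mono (hφ : IsAdmissiblePropagator φ) {s s' t t' : ℝ}
    (hs : s' ≤ s) (hst : s < t) (ht : t ≤ t') : decay (φ s t) ≤ decay (φ s' t') := by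
  have h1 : decay (φ s t) ≤ decay (φ s' t) := by
    rcases hs.eq_or_lt with rfl | h
    · exact le_rfl
    · exact le_add_self.trans (hφ.decay_add_le h hst)
  refine h1.trans ?_
  rcases ht.eq_or_lt with rfl | h
  · exact le_rfl
  · exact le_self_add.trans (hφ.decay_add_le (hs.trans_lt hst) h)

end Propagator

/-! ### The decay rate of a stationary propagator. -/

section Stationary

open Filter Topology MeasureTheory
open scoped ENNReal

variable {D : ℕ} {Ω : Type*}

lemma iterate_vadd [AddAction ℝ Ω] (h : ℝ) (n : ℕ) (ω : Ω) :
    (fun ω : Ω => h +ᵥ ω)^[n] ω = ((n : ℝ) * h) +ᵥ ω := by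
  rw [← nsmul_eq_mul]
  exact vadd_iterate_apply h n ω

/-- `-ln c(φ_{s,t})` on the event `G`, as a measurable function. -/
noncomputable def decayOn (G : Set Ω) (φ : ℝ → ℝ → Ω → SuperOp D) (s t : ℝ) (ω : Ω) : ℝ≥0∞ :=
  negLn (G.indicator (fun ω => contractionCoeff (φ s t ω)) ω)

lemma decayOn_of_mem {G : Set Ω} {φ : ℝ → ℝ → Ω → SuperOp D} {s t : ℝ} {ω : Ω} (h : ω ∈ G) :
    decayOn G φ s t ω = decay (φ s t ω) := by
  rw [decayOn, Set.indicator_of_mem h, decay]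

/-- The process `-ln c(φ_{0,n})`, started at `0`. -/
noncomputable def forwardDecay (G : Set Ω) (φ : ℝ → ℝ → Ω → SuperOp D) : ℕ → Ω → ℝ≥0∞
  -- `φ 0 0` is unconstrained, so the value at time zero is fixed by hand.
  | 0, _ => 0
  | n + 1, ω => decayOn G φ 0 (n + 1 : ℕ) ω

/-- The process `-ln c(φ_{-n,0})`, started at `0`. -/
noncomputable def backwardDecay (G : Set Ω) (φ : ℝ → ℝ → Ω → SuperOp D) : ℕ → Ω → ℝ≥0∞
  | 0, _ => 0
  | n + 1, ω => decayOn G φ (-(n + 1 : ℕ)) 0 ω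

lemma forwardDecay_of_mem {G : Set Ω} {φ : ℝ → ℝ → Ω → SuperOp D} {n : ℕ} (hn : 0 < n) {ω : Ω}
    (h : ω ∈ G) : forwardDecay G φ n ω = decay (φ 0 n ω) := by
  obtain ⟨n, rfl⟩ := Nat.exists_eq_succ_of_ne_zero hn.ne'
  exact decayOn_of_mem h

lemma backwardDecay_of_mem {G : Set Ω} {φ : ℝ → ℝ → Ω → SuperOp D} {n : ℕ} (hn : 0 < n) {ω : Ω}
    (h : ω ∈ G) : backwardDecay G φ n ω = decay (φ (-n) 0 ω) := by
  obtain ⟨n, rfl⟩ := Nat.exists_eq_succ_of_ne_zero hn.ne'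
  exact decayOn_of_mem h

variable [MeasurableSpace Ω] {μ : Measure Ω} [AddAction ℝ Ω]
  {φ : ℝ → ℝ → Ω → SuperOp D} {G : Set Ω}

lemma ae_vadd [MeasurableConstVAdd ℝ Ω] [VAddInvariantMeasure ℝ Ω μ]
    {p : Ω → Prop} (h : ℝ) (hp : ∀ᵐ ω ∂μ, p ω) : ∀ᵐ ω ∂μ, p (h +ᵥ ω) :=
  (measurePreserving_vadd h μ).quasiMeasurePreserving.ae hp

lemma backwardDecay_eq [MeasurableConstVAdd ℝ Ω] [VAddInvariantMeasure ℝ Ω μ]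
    (hφ : IsDynamicalPropagator μ φ)
    (hGμ : ∀ᵐ ω ∂μ, ω ∈ G) (n : ℕ) :
    ∀ᵐ ω ∂μ, backwardDecay G φ n ω = forwardDecay G φ n ((fun ω => (-1 : ℝ) +ᵥ ω)^[n] ω) := by
  rcases Nat.eq_zero_or_pos n with rfl | hn
  · exact Eventually.of_forall fun _ => rfl
  filter_upwards [hφ.stationary (-n) 0 n (by exact_mod_cast hn), hGμ, ae_vadd (-n) hGμ]
    with ω h1 h2 h3
  rw [iterate_vadd, mul_neg, mul_one, backwardDecay_of_mem hn h2, forwardDecay_of_mem hn h3, ← h1,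
    zero_add, add_neg_cancel]

variable [NeZero D]

lemma measurable_decayOn (hφ : IsDynamicalPropagator μ φ) (hG : MeasurableSet G)
    (ha : ∀ ω ∈ G, IsAdmissiblePropagator fun s t => φ s t ω) {s t : ℝ} (hst : s < t) :
    Measurable (decayOn G φ s t) :=
  measurable_negLn.comp (measurable_indicator_contractionCoeff hG (hφ.measurable s t hst)
    fun ω h => (ha ω h).admissible s t hst)

lemma measurable_forwardDecay (hφ : IsDynamicalPropagator μ φ) (hG : MeasurableSet G)
    (ha : ∀ ω ∈ G, IsAdmissiblePropagator fun s t => φ s t ω) (n : ℕ) :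
    Measurable (forwardDecay G φ n) := by
  cases n with
  | zero => exact measurable_const
  | succ n => exact measurable_decayOn hφ hG ha (by positivity)

lemma measurable_backwardDecay (hφ : IsDynamicalPropagator μ φ) (hG : MeasurableSet G)
    (ha : ∀ ω ∈ G, IsAdmissiblePropagator fun s t => φ s t ω) (n : ℕ) :
    Measurable (backwardDecay G φ n) := by
  cases n with
  | zero => exact measurable_const
  | succ n => exact measurable_decayOn hφ hG ha (by rw [neg_lt_zero]; positivity)

variable [MeasurableConstVAdd ℝ Ω] [VAddInvariantMeasure ℝ Ω μ]

lemma isSuperadditive_forwardDecay (hφ : IsDynamicalPropagator μ φ) (hG : MeasurableSet G)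
    (hGμ : ∀ᵐ ω ∂μ, ω ∈ G) (ha : ∀ ω ∈ G, IsAdmissiblePropagator fun s t => φ s t ω) :
    IsSuperadditive μ (fun ω => (1 : ℝ) +ᵥ ω) (forwardDecay G φ) := by
  refine ⟨measurable_forwardDecay hφ hG ha, ?_⟩
  have h1 : ∀ᵐ ω ∂μ, ∀ m : ℕ, (m : ℝ) +ᵥ ω ∈ G := ae_all_iff.2 fun m => ae_vadd _ hGμ
  have h2 : ∀ᵐ ω ∂μ, ∀ m n : ℕ, 0 < n → φ (0 + m) (n + m) ω = φ 0 n ((m : ℝ) +ᵥ ω) := by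
    refine ae_all_iff.2 fun m => ae_all_iff.2 fun n => ?_
    by_cases hn : 0 < n
    · filter_upwards [hφ.stationary m 0 n (by exact_mod_cast hn)] with ω h _ using h
    · exact Eventually.of_forall fun _ h => absurd h hn
  filter_upwards [h1, h2, hGμ] with ω h1 h2 h3 m n
  rw [iterate_vadd, mul_one]
  rcases Nat.eq_zero_or_pos m with rfl | hm
  · simp [forwardDecay]
  rcases Nat.eq_zero_or_pos n with rfl | hn
  · simp [forwardDecay]
  rw [forwardDecay_of_mem hm h3, forwardDecay_of_mem hn (h1 m),
    forwardDecay_of_mem (Nat.add_pos_left hm n) h3, ← h2 m n hn, zero_add, add_comm m n,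
    Nat.cast_add]
  exact (ha ω h3).decay_add_le (by exact_mod_cast hm)
    (lt_add_of_pos_left _ (by exact_mod_cast hn))

lemma isSuperadditive_backwardDecay (hφ : IsDynamicalPropagator μ φ) (hG : MeasurableSet G)
    (hGμ : ∀ᵐ ω ∂μ, ω ∈ G) (ha : ∀ ω ∈ G, IsAdmissiblePropagator fun s t => φ s t ω) :
    IsSuperadditive μ (fun ω => (-1 : ℝ) +ᵥ ω) (backwardDecay G φ) := by
  refine ⟨measurable_backwardDecay hφ hG ha, ?_⟩
  have h1 : ∀ᵐ ω ∂μ, ∀ m : ℕ, (-m : ℝ) +ᵥ ω ∈ G := ae_all_iff.2 fun m => ae_vadd _ hGμ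
  have h2 : ∀ᵐ ω ∂μ, ∀ m n : ℕ, 0 < n → φ (-n + -m) (0 + -m) ω = φ (-n) 0 ((-m : ℝ) +ᵥ ω) := by
    refine ae_all_iff.2 fun m => ae_all_iff.2 fun n => ?_
    by_cases hn : 0 < n
    · filter_upwards [hφ.stationary (-m) (-n) 0 (by rw [neg_lt_zero]; exact_mod_cast hn)] with ω h _
        using h
    · exact Eventually.of_forall fun _ h => absurd h hn
  filter_upwards [h1, h2, hGμ] with ω h1 h2 h3 m n
  rw [iterate_vadd, mul_neg, mul_one]
  rcases Nat.eq_zero_or_pos m with rfl | hm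
  · simp [backwardDecay]
  rcases Nat.eq_zero_or_pos n with rfl | hn
  · simp [backwardDecay]
  rw [backwardDecay_of_mem hm h3, backwardDecay_of_mem hn (h1 m),
    backwardDecay_of_mem (Nat.add_pos_left hm n) h3, ← h2 m n hn, zero_add, add_comm m n,
    Nat.cast_add, neg_add, add_comm (decay _)]
  exact (ha ω h3).decay_add_le (add_lt_of_neg_left _ (by rw [neg_lt_zero]; exact_mod_cast hn))
    (by rw [neg_lt_zero]; exact_mod_cast hm)

/-- The almost sure exponential decay rate of `c(φ_{0,n})`. -/
noncomputable def decayRate (G : Set Ω) (φ : ℝ → ℝ → Ω → SuperOp D) (ω : Ω) : ℝ≥0∞ :=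
  liminf (fun n : ℕ => forwardDecay G φ n ω / n) atTop

lemma tendsto_decay [IsFiniteMeasure μ] (hφ : IsDynamicalPropagator μ φ) (hG : MeasurableSet G)
    (hGμ : ∀ᵐ ω ∂μ, ω ∈ G) (ha : ∀ ω ∈ G, IsAdmissiblePropagator fun s t => φ s t ω) :
    ∀ᵐ ω ∂μ,
      Tendsto (fun t : ℝ => decay (φ 0 t ω) / ENNReal.ofReal t) atTop (𝓝 (decayRate G φ ω)) ∧
      Tendsto (fun t : ℝ => decay (φ (-t) 0 ω) / ENNReal.ofReal t) atTop
        (𝓝 (decayRate G φ ω)) := by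
  have h := (isSuperadditive_forwardDecay hφ hG hGμ ha).tendsto_of_inverse
    (measurePreserving_vadd (1 : ℝ) μ) (measurePreserving_vadd (-1 : ℝ) μ)
    (fun ω => by simp [vadd_vadd]) (fun ω => by simp [vadd_vadd])
    (isSuperadditive_backwardDecay hφ hG hGμ ha) (backwardDecay_eq hφ hGμ)
  filter_upwards [h, hGμ] with ω h hω
  constructor
  · refine tendsto_div_real_of_nat (fun s t hs hst => (ha ω hω).decay_mono le_rfl hs hst) ?_
    refine h.1.congr' ?_
    filter_upwards [eventually_gt_atTop 0] with n hn
    rw [forwardDecay_of_mem hn hω]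
  · refine tendsto_div_real_of_nat (G := fun t => decay (φ (-t) 0 ω)) (fun s t hs hst =>
      (ha ω hω).decay_mono (neg_le_neg hst) (neg_lt_zero.2 hs) le_rfl) ?_
    refine h.2.congr' ?_
    filter_upwards [eventually_gt_atTop 0] with n hn
    rw [backwardDecay_of_mem hn hω]

lemma measurable_decayRate (hφ : IsDynamicalPropagator μ φ) (hG : MeasurableSet G)
    (hGμ : ∀ᵐ ω ∂μ, ω ∈ G) (ha : ∀ ω ∈ G, IsAdmissiblePropagator fun s t => φ s t ω) :
    Measurable (decayRate G φ) :=
  (isSuperadditive_forwardDecay hφ hG hGμ ha).measurable_liminf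

/-- For `h ≥ 0` the interval `[h, n + h]` lies in `[0, n + ⌈h⌉]`, so the rate does not increase
under the shift and is therefore invariant. Negative `h` follows by inverting the shift. -/
lemma decayRate_vadd [IsFiniteMeasure μ] (hφ : IsDynamicalPropagator μ φ) (hG : MeasurableSet G)
    (hGμ : ∀ᵐ ω ∂μ, ω ∈ G) (ha : ∀ ω ∈ G, IsAdmissiblePropagator fun s t => φ s t ω) (h : ℝ) :
    ∀ᵐ ω ∂μ, decayRate G φ (h +ᵥ ω) = decayRate G φ ω := by
  have hpos : ∀ h : ℝ, 0 ≤ h → ∀ᵐ ω ∂μ, decayRate G φ (h +ᵥ ω) = decayRate G φ ω := by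
    intro h hh
    refine ae_comp_eq_of_ae_comp_le (T := fun ω => h +ᵥ ω) (measurePreserving_vadd h μ)
      (measurable_decayRate hφ hG hGμ ha) ?_
    have h2 : ∀ᵐ ω ∂μ, ∀ n : ℕ, 0 < n → φ (0 + h) (n + h) ω = φ 0 n (h +ᵥ ω) := by
      refine ae_all_iff.2 fun n => ?_
      by_cases hn : 0 < n
      · filter_upwards [hφ.stationary h 0 n (by exact_mod_cast hn)] with ω h _ using h
      · exact Eventually.of_forall fun _ h => absurd h hn
    filter_upwards [h2, hGμ, ae_vadd h hGμ] with ω h2 h3 h4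
    refine liminf_div_le_of_shift (k := ⌈h⌉₊) fun n => ?_
    rcases Nat.eq_zero_or_pos n with rfl | hn
    · simp [forwardDecay]
    rw [forwardDecay_of_mem hn h4, ← h2 n hn, forwardDecay_of_mem (Nat.add_pos_left hn _) h3]
    refine (ha ω h3).decay_mono (by linarith) ?_ ?_
    · have : (0 : ℝ) < n := by exact_mod_cast hn
      linarith
    · push_cast
      linarith [Nat.le_ceil h]
  rcases le_total 0 h with hh | hh
  · exact hpos h hh
  · filter_upwards [ae_vadd h (hpos (-h) (by linarith))] with ω hω
    rw [neg_vadd_vadd] at hω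
    exact hω.symm

lemma decayRate_pos [IsFiniteMeasure μ] (hφ : IsDynamicalPropagator μ φ) (hG : MeasurableSet G)
    (hGμ : ∀ᵐ ω ∂μ, ω ∈ G) (ha : ∀ ω ∈ G, IsAdmissiblePropagator fun s t => φ s t ω)
    (hpos : ∀ᵐ ω ∂μ, ∃ s t : ℝ, s < t ∧ IsStrictlyPositiveMap (φ s t ω)) :
    ∀ᵐ ω ∂μ, 0 < decayRate G φ ω := by
  have h0 := (isSuperadditive_forwardDecay hφ hG hGμ ha).eq_zero_of_liminf_eq_zero
    (measurePreserving_vadd (1 : ℝ) μ)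
  have key : ∀ᵐ ω ∂μ, ∀ n : ℕ, 0 < n → decayRate G φ ω = 0 → decay (φ (-n) n ω) = 0 := by
    refine ae_all_iff.2 fun n => ?_
    by_cases hn : 0 < n
    swap
    · exact Eventually.of_forall fun _ h => absurd h hn
    -- Seen from the point shifted by `-n`, the interval `[-n, n]` becomes `[0, 2n]`, where the
    -- forward process vanishes if the rate does.
    filter_upwards [ae_vadd (-n) h0, decayRate_vadd hφ hG hGμ ha (-n), ae_vadd (-n) hGμ,
      hφ.stationary (-n) 0 (2 * n : ℕ) (by positivity)] with ω h1 h2 h3 h4 _ h5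
    have := h1 (h2.trans h5) (2 * n)
    rw [forwardDecay_of_mem (by omega) h3, ← h4] at this
    rw [← this]
    congr 2
    · ring
    · push_cast; ring
  filter_upwards [key, hpos, hGμ] with ω h1 ⟨s, t, hst, hs⟩ hω
  refine pos_iff_ne_zero.2 fun h => ?_
  obtain ⟨n, hn⟩ := exists_nat_gt (max |s| |t|)
  have hs' := (le_max_left |s| |t|).trans_lt hn
  have ht' := (le_max_right |s| |t|).trans_lt hn
  have hn0 : 0 < n := by exact_mod_cast (abs_nonneg s).trans_lt hs'
  have hlt : 0 < decay (φ s t ω) :=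
    negLn_pos (hs.contractionCoeff_lt_one ((ha ω hω).admissible s t hst))
  have hle := (ha ω hω).decay_mono (s' := -n) (t' := n) (abs_lt.1 hs').1.le hst (abs_lt.1 ht').2.le
  rw [h1 n hn0 h] at hle
  exact hle.not_gt hlt

/-- `exp(-x)` as a real number. -/
noncomputable def expNeg (x : ℝ≥0∞) : ℝ := (EReal.exp (-(x : EReal))).toReal

lemma exp_neg_le_one (x : ℝ≥0∞) : EReal.exp (-(x : EReal)) ≤ 1 := by
  rw [EReal.exp_le_one_iff, EReal.neg_le_zero]
  exact EReal.coe_ennreal_nonneg x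

lemma ln_expNeg (x : ℝ≥0∞) : ln (expNeg x) = -(x : EReal) := by
  rw [ln, expNeg, ENNReal.ofReal_toReal (ne_top_of_le_ne_top ENNReal.one_ne_top (exp_neg_le_one x)),
    EReal.log_exp]

lemma expNeg_nonneg (x : ℝ≥0∞) : 0 ≤ expNeg x := ENNReal.toReal_nonneg

lemma expNeg_lt_one {x : ℝ≥0∞} (hx : 0 < x) : expNeg x < 1 := by
  have h : EReal.exp (-(x : EReal)) < 1 := by
    rw [EReal.exp_lt_one_iff, EReal.neg_lt_zero]
    exact_mod_cast hx
  exact (ENNReal.toReal_lt_toReal h.ne_top ENNReal.one_ne_top).2 h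

lemma measurable_expNeg : Measurable expNeg := by
  unfold expNeg
  fun_prop

end Stationary

end StationaryQuantum

/-! ### Assembly of the theorem. -/

theorem lemma3p1 {D : ℕ} [NeZero D] {Ω : Type*} [MeasurableSpace Ω]
    (μ : MeasureTheory.Measure Ω) [MeasureTheory.IsProbabilityMeasure μ]
    [AddAction ℝ Ω] [MeasurableConstVAdd ℝ Ω] [MeasureTheory.VAddInvariantMeasure ℝ Ω μ]
    (φ : ℝ → ℝ → Ω → StationaryQuantum.SuperOp D)
    (hφ : StationaryQuantum.IsDynamicalPropagator μ φ)
    (hker : ∀ᵐ ω ∂μ, ∀ s t : ℝ, s < t → StationaryQuantum.IsNonDestructive (φ s t ω))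
    (hpos : ∀ᵐ ω ∂μ, ∃ s t : ℝ, s < t ∧ StationaryQuantum.IsStrictlyPositiveMap (φ s t ω)) :
    ∃ κ : Ω → ℝ, Measurable κ ∧ (∀ ω, 0 ≤ κ ω) ∧ (∀ᵐ ω ∂μ, κ ω < 1) ∧
      (∀ᵐ ω ∂μ, Filter.Tendsto
        (fun t : ℝ => ((1 / t : ℝ) : EReal) *
          StationaryQuantum.ln (StationaryQuantum.contractionCoeff (φ 0 t ω)))
        Filter.atTop (nhds (StationaryQuantum.ln (κ ω)))) ∧
      (∀ᵐ ω ∂μ, Filter.Tendsto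
        (fun s : ℝ => ((1 / |s| : ℝ) : EReal) *
          StationaryQuantum.ln (StationaryQuantum.contractionCoeff (φ s 0 ω)))
        Filter.atBot (nhds (StationaryQuantum.ln (κ ω)))) ∧
      (∀ h : ℝ, ∀ᵐ ω ∂μ, κ (h +ᵥ ω) = κ ω) ∧
      (ErgodicVAdd ℝ Ω μ → ∃ k : ℝ, 0 ≤ k ∧ k < 1 ∧ ∀ᵐ ω ∂μ, κ ω = k) := by
  open StationaryQuantum Filter MeasureTheory in
  have hgood : ∀ᵐ ω ∂μ, IsAdmissiblePropagator fun s t => φ s t ω := by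
    filter_upwards [hφ.positive, hker, hφ.propagate] with ω h1 h2 h3
    exact ⟨fun s t h => ⟨h1 s t h, h2 s t h⟩, h3⟩
  -- The good event need not be measurable, so it is replaced by a measurable subset of full
  -- measure.
  obtain ⟨G, hGmem, hG, ha⟩ := hgood.exists_measurable_mem
  have hGμ : ∀ᵐ ω ∂μ, ω ∈ G := hGmem
  have hlim := tendsto_decay hφ hG hGμ ha
  have hinv : ∀ h : ℝ, ∀ᵐ ω ∂μ, expNeg (decayRate G φ (h +ᵥ ω)) = expNeg (decayRate G φ ω) :=
    fun h => (decayRate_vadd hφ hG hGμ ha h).mono fun ω hω => congrArg expNeg hω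
  have hlt : ∀ᵐ ω ∂μ, expNeg (decayRate G φ ω) < 1 :=
    (decayRate_pos hφ hG hGμ ha hpos).mono fun ω => expNeg_lt_one
  have hm : Measurable fun ω => expNeg (decayRate G φ ω) :=
    measurable_expNeg.comp (measurable_decayRate hφ hG hGμ ha)
  refine ⟨fun ω => expNeg (decayRate G φ ω), hm, fun ω => expNeg_nonneg _, hlt, ?_, ?_, hinv, ?_⟩
  · filter_upwards [hlim, hGμ] with ω h hω
    rw [ln_expNeg]
    refine ((continuous_neg.comp continuous_coe_ennreal_ereal).tendsto _ |>.comp h.1).congr' ?_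
    filter_upwards [eventually_gt_atTop 0] with t ht
    exact (inv_mul_ln_eq ((ha ω hω).admissible 0 t ht).contractionCoeff_le_one ht).symm
  · filter_upwards [hlim, hGμ] with ω h hω
    rw [ln_expNeg]
    refine (((continuous_neg.comp continuous_coe_ennreal_ereal).tendsto _ |>.comp h.2).comp
      tendsto_neg_atBot_atTop).congr' ?_
    filter_upwards [eventually_lt_atBot 0] with s hs
    simp only [Function.comp_apply, neg_neg]
    rw [abs_of_neg hs]
    exact (inv_mul_ln_eq ((ha ω hω).admissible s 0 hs).contractionCoeff_le_one
      (neg_pos.2 hs)).symm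
  · intro herg
    obtain ⟨k, hk⟩ : ∃ k : ℝ, (fun ω => expNeg (decayRate G φ ω)) =ᵐ[μ] Function.const Ω k := by
      -- Each event `κ ∈ U` is almost invariant, hence trivial by ergodicity; measurable sets of
      -- reals separate points countably, so `κ` is almost surely constant.
      refine exists_eventuallyEq_const_of_forall_separating MeasurableSet fun U hU => ?_
      refine eventuallyConst_set.1 (aeconst_of_forall_preimage_vadd_ae_eq ℝ
        (hm hU).nullMeasurableSet fun h => ?_)
      refine eventuallyEq_set.2 ((hinv h).mono fun ω hω => ?_)
      change expNeg (decayRate G φ (h +ᵥ ω)) ∈ U ↔ expNeg (decayRate G φ ω) ∈ U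
      rw [hω]
    obtain ⟨ω, h1, h2⟩ := (hk.and hlt).exists
    replace h1 : expNeg (decayRate G φ ω) = k := h1
    exact ⟨k, h1 ▸ expNeg_nonneg _, h1 ▸ h2, hk⟩
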